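/- Let $\mathcal X$ be a nonsingular, projective, geometrically irreducible algebraic curve over the finite field $\mathbb F_q$, given by its function field $K=\mathbb F_q(\mathcal X)$ (a finitely generated extension of $\mathbb F_q$ of transcendence degree one in which $\mathbb F_q$ is algebraically closed); the closed points of $\mathcal X$ are the places of $K$ over $\mathbb F_q$, with normalized discrete valuations $v_P$, and the rational points are the places with residue field $\mathbb F_q$. Let $m\ge 2$, let $\mathbf Q=(Q_1,\dots,Q_m)$ be an $m$-tuple of pairwise distinct rational points of $\mathcal X$, and put $I=\{1,\dots,m\}$. For a divisor $D$ let $\mathcal L(D)=\{h\in K^\times:\operatorname{div}(h)+D\ge 0\}\cup\{0\}$ and $\ell(D)=\dim_{\mathbb F_q}\mathcal L(D)$. For $\alpha\in\mathbb Z^m$ let $D_\alpha=\sum_{i=1}^m\alpha_iQ_i$. Let $$H(\mathbf Q)=\Big\{\alpha\in\mathbb N_0^m:\ \text{there is } h\in K^\times \text{ whose divisor of poles is } \sum_{i=1}^m\alpha_iQ_i\Big\},\qquad G(\mathbf Q)=\mathbb N_0^m\setminus H(\mathbf Q),$$ and let the set of pure gaps be $$G_0(\mathbf Q)=\{\alpha\in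 G(\mathbf Q):\ \ell(D_\alpha)=\ell(D_\alpha-Q_j)\ \text{ for all } j\in I\}.$$ Let $\widehat H(\mathbf Q)$ be the set of all tuples $(-v_{Q_1}(h),\dots,-v_{Q_m}(h))\in\mathbb Z^m$, where $h\in K^\times$ is regular at every point outside $\{Q_1,\dots,Q_m\}$. For $J\subseteq I$, $i\in I$ and $\alpha\in\mathbb Z^m$ let $$\overline\nabla_J(\alpha)=\{\beta\in\mathbb Z^m:\ \beta_j=\alpha_j \text{ for } j\in J,\ \beta_s<\alpha_s\text{ for } s\in I\setminus J\},\qquad \overline\nabla_i(\alpha)=\overline\nabla_{\{i\}}(\alpha).$$ An element $\alpha\in\widehat H(\mathbf Q)$ is called relative maximal if $\widehat H(\mathbf Q)\cap\overline\nabla_i(\alpha)=\emptyset$ for all $i\in I$, and $\widehat H(\mathbf Q)\cap\overline\nabla_J(\alpha)\ne\emptyset$ for every $J\subsetneq I$ with $\#J\ge 2$. Let $\widehat\Lambda(\mathbf Q)$ be the set of relative maximal elements of $\widehat H(\mathbf Q)$, and $\Lambda(\mathbf Q)=\widehat\Lambda(\mathbf Q)\cap\mathbb N_0^m$. Assume that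 $q\ge m$. Then $$G_0(\mathbf Q)=\bigcup_{(\beta^1,\dots,\beta^m)\in\Lambda(\mathbf Q)^m}\ \bigcap_{i=1}^m\overline\nabla_i(\beta^i).$$ Moreover, for all $\beta^1,\dots,\beta^m\in\widehat\Lambda(\mathbf Q)$ (in particular for those that occur in this union), the intersection $\bigcap_{i=1}^m\overline\nabla_i(\beta^i)$ is either empty or equal to the single point $\{(\beta^1_1,\beta^2_2,\dots,\beta^m_m)\}$. -/

import Mathlib

open scoped WithZero

noncomputable section

namespace WeierstrassGap

universe u v

/-! A (nonsingular, projective, geometrically irreducible) curve over a finite field `k` is given by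
its function field `K`; the closed points of the curve are the places of `K` over `k`, and the
rational points are the places whose residue field is `k`. -/

/-- `K` is an algebraic function field in one variable over `k` whose full constant field is `k`:
it is finitely generated of transcendence degree one over `k`, and `k` is algebraically closed
in `K`. For `k` perfect these are the function fields of the nonsingular, projective,
geometrically irreducible curves over `k`. -/
structure IsCurveFunctionField (k : Type u) (K : Type v) [Field k] [Field K] [Algebra k K] :
    Prop where
  fg : (⊤ : IntermediateField k K).FG
  trdeg_eq_one : Algebra.trdeg k K = 1
  constants : algebraicClosure k K = ⊥

/-- A place of `K` over `k`, given by its valuation ring: a discrete valuation ring with field of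
fractions `K` that contains `k`. -/
@[ext]
structure Place (k : Type u) (K : Type v) [Field k] [Field K] [Algebra k K] where
  /-- the valuation ring of the place -/
  ring : ValuationSubring K
  algebraMap_mem : ∀ a : k, algebraMap k K a ∈ ring
  isDVR : IsDiscreteValuationRing ring

attribute [instance] Place.isDVR

variable {k : Type u} {K : Type v} [Field k] [Field K] [Algebra k K]

/-- The multiplicative adic valuation of the place `P`, with value group `ℤ`. -/
def Place.valuation (P : Place k K) : Valuation K ℤᵐ⁰ :=
  (IsDiscreteValuationRing.maximalIdeal P.ring).valuation K

/-- The normalized discrete valuation `v_P(f)` of a nonzero function `f`: its order of vanishing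
at `P`. (At `f = 0` the value is the meaningless `0`.) -/
def Place.ord (P : Place k K) (f : K) : ℤ := -WithZero.log (P.valuation f)

/-- `P` is a rational place: every element of its residue field is the residue of a constant. -/
def Place.IsRational (P : Place k K) : Prop :=
  ∀ x : P.ring, ∃ a : k, IsLocalRing.residue P.ring x =
    IsLocalRing.residue P.ring ⟨algebraMap k K a, P.algebraMap_mem a⟩

lemma Place.valuation_le_one {P : Place k K} {x : K} (hx : x ∈ P.ring) : P.valuation x ≤ 1 :=
  (IsDiscreteValuationRing.maximalIdeal P.ring).valuation_le_one (K := K) ⟨x, hx⟩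

lemma Place.ord_add_nonneg_iff (P : Place k K) {f : K} (hf : f ≠ 0) (n : ℤ) :
    0 ≤ P.ord f + n ↔ P.valuation f ≤ WithZero.exp n := by
  rw [← WithZero.log_le_iff_le_exp ((Valuation.ne_zero_iff _).2 hf), Place.ord]
  constructor <;> intro h <;> linarith

/-- Divisors: finite formal `ℤ`-linear combinations of places. -/
abbrev Divisor (k : Type u) (K : Type v) [Field k] [Field K] [Algebra k K] : Type v :=
  Place k K →₀ ℤ

lemma mem_riemannRoch_iff (D : Divisor k K) (f : K) :
    (f = 0 ∨ ∀ P : Place k K, 0 ≤ P.ord f + D P) ↔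
      ∀ P : Place k K, P.valuation f ≤ WithZero.exp (D P) := by
  by_cases hf : f = 0
  · simp [hf]
  · simp only [hf, false_or, Place.ord_add_nonneg_iff _ hf]

/-- The Riemann-Roch space `L(D) = {f : div(f) + D ≥ 0} ∪ {0}`. -/
def riemannRoch (D : Divisor k K) : Submodule k K where
  carrier := {f | f = 0 ∨ ∀ P : Place k K, 0 ≤ P.ord f + D P}
  zero_mem' := Or.inl rfl
  add_mem' := by
    intro f g hf hg
    rw [Set.mem_ofPred_eq, mem_riemannRoch_iff] at hf hg ⊢
    exact fun P => (P.valuation.map_add f g).trans (max_le (hf P) (hg P))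
  smul_mem' := by
    intro c f hf
    rw [Set.mem_ofPred_eq, mem_riemannRoch_iff] at hf ⊢
    intro P
    rw [Algebra.smul_def, map_mul]
    exact (mul_le_of_le_one_left' (Place.valuation_le_one (P.algebraMap_mem c))).trans (hf P)

/-- `ℓ(D)`, the dimension of `L(D)` over `k`. -/
def ell (D : Divisor k K) : ℕ := Module.finrank k (riemannRoch D)

/-- The divisor of poles of a nonzero function `h`, as a function on places: its coefficient
at `P` is `max(0, -v_P(h))`. -/
def poleDivisor (h : K) (P : Place k K) : ℤ := max 0 (-P.ord h)

variable {m : ℕ}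

/-- The divisor `D_α = α₁ Q₁ + ⋯ + α_m Q_m`. -/
def tupleDivisor (Q : Fin m → Place k K) (α : Fin m → ℤ) : Divisor k K :=
  ∑ i, Finsupp.single (Q i) (α i)

/-- The classical Weierstrass semigroup `H(Q)`, as a set of nonnegative integer tuples. -/
def semigroup (Q : Fin m → Place k K) : Set (Fin m → ℤ) :=
  {α | 0 ≤ α ∧ ∃ h : K, h ≠ 0 ∧ ∀ P : Place k K, poleDivisor h P = tupleDivisor Q α P}

/-- The set `G(Q)` of Weierstrass gaps, the complement of `H(Q)` among the nonnegative tuples. -/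
def gaps (Q : Fin m → Place k K) : Set (Fin m → ℤ) := {α | 0 ≤ α} \ semigroup Q

/-- The set `G₀(Q)` of pure Weierstrass gaps. -/
def pureGaps (Q : Fin m → Place k K) : Set (Fin m → ℤ) :=
  {α | α ∈ gaps Q ∧
    ∀ j, ell (tupleDivisor Q α) = ell (tupleDivisor Q α - Finsupp.single (Q j) 1)}

/-- The set `R_Q` of the functions that are regular at all places outside `{Q₁, …, Q_m}`. -/
def regularOutside (Q : Fin m → Place k K) : Set K :=
  {h | ∀ P : Place k K, P ∉ Set.range Q → h ∈ P.ring}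

/-- The generalized Weierstrass semigroup `Ĥ(Q)`. -/
def genSemigroup (Q : Fin m → Place k K) : Set (Fin m → ℤ) :=
  {α | ∃ h ∈ regularOutside Q, h ≠ 0 ∧ ∀ i, α i = -(Q i).ord h}

/-- The set `∇̄_J(α)` of the integer tuples that agree with `α` on `J` and are smaller
than `α` in every coordinate outside `J`. -/
def nablaBar (J : Finset (Fin m)) (α : Fin m → ℤ) : Set (Fin m → ℤ) :=
  {β | (∀ j ∈ J, β j = α j) ∧ ∀ i ∉ J, β i < α i}

/-- `∇_J(α) = ∇̄_J(α) ∩ Ĥ(Q)`. -/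
def nabla (Q : Fin m → Place k K) (J : Finset (Fin m)) (α : Fin m → ℤ) : Set (Fin m → ℤ) :=
  nablaBar J α ∩ genSemigroup Q

/-- `α` is a maximal element of `Ĥ(Q)`: `∇(α)`, the union of the `∇_{i}(α)`, is empty. -/
def IsMaximal (Q : Fin m → Place k K) (α : Fin m → ℤ) : Prop :=
  α ∈ genSemigroup Q ∧ (⋃ i, nablaBar {i} α) ∩ genSemigroup Q = ∅

/-- The set `Λ̂(Q)` of relative maximal elements: the maximal elements `α` of `Ĥ(Q)` such that
`∇_J(α)` is nonempty for every proper subset `J` of the index set with at least two elements. -/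
def relMaximals (Q : Fin m → Place k K) : Set (Fin m → ℤ) :=
  {α | IsMaximal Q α ∧ ∀ J : Finset (Fin m), J ⊂ Finset.univ → 2 ≤ J.card →
    (nabla Q J α).Nonempty}

/-- `Λ(Q)`, the set of the relative maximal elements with nonnegative coordinates. -/
def nonnegRelMaximals (Q : Fin m → Place k K) : Set (Fin m → ℤ) :=
  relMaximals Q ∩ {α | 0 ≤ α}

end WeierstrassGap

end

/-!
The proof replaces differentials by linear functionals and needs neither the Riemann-Roch theorem
nor the degree of a principal divisor.

Let `R` be the space of the functions regular outside `Q₁, …, Q_m`. Since all `L(D_α)` are finite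
dimensional, `α ≥ 0` is a pure gap if and only if no function in `R` with poles bounded by `α`
attains the bound at some `Q_i` (`mem_pureGaps_iff`). If `α_i = β^i_i` and `α_s < β^i_s` for
`s ≠ i`, with `β^i` maximal, a function that attains the bound at `Q_i` contradicts the maximality
of `β^i`; this is one inclusion.

For the other one, fix a pure gap `α` and an index `i`. That the bound `α` is not attained at `Q_i`
means, by duality of vector spaces, that there is a family of functionals `λ = (λ₁, …, λ_m)` on `K`
which kills `R` embedded diagonally, is nonzero on a function with pole order `α_i` at `Q_i`, and
such that `λ_s` kills the functions with pole order at most `α_s` for `s ≠ i` and less than `α_i`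
for `s = i` (`residueForms`, `exists_residueForm_ne_zero`). Choose `λ` with the tuple `γ` of its
conductors maximal. Then `γ_i = α_i` and `γ_s > α_s` otherwise, and `γ` is relative maximal
(`mem_relMaximals_of_maximal`): the leading coefficients at the `Q_s` of the functions in `R` with
poles bounded by `γ` are killed by the leading coefficients of `λ`, all of which are nonzero, and by
no other functional, since a second one could be combined with `λ` to enlarge `γ`. So they fill a
hyperplane, equivalent to `c₁ + ⋯ + c_m = 0`. It contains no vector with a single nonzero entry,
while for `2 ≤ |J| ≤ q` it contains vectors with support exactly `J`; here `q ≥ m` is used.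

That `γ` is bounded, so that a maximal choice exists, is strong approximation
(`exists_strong_approx`): for `s ≠ i` there is a function with the pole order `α_i` at `Q_i` whose
only other pole is at `Q_s`. It rests on the finiteness of `K / (A + B)`, where `A` and `B` consist
of the functions regular at the places where a given `x` is regular, respectively has a pole
(`finiteDimensional_quotient_regularOn_sup`), and on the remark that a subspace of finite
codimension in `K` that is stable under a transcendental `f` is all of `K`
(`eq_top_of_finiteDimensional_quotient`). Places with a prescribed pole, needed for the finite
dimension of `L(D_α)`, are valuation rings; these are discrete by a count of elements that are
linearly independent over `k(x)`.
-/

namespace WeierstrassGap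

open Polynomial IntermediateField

universe u w

/-! ### Valuations of rational functions in one element -/

section Valuations
variable {k K Γ : Type*} [Field k] [Field K] [Algebra k K] [LinearOrderedCommGroupWithZero Γ]

lemma map_algebraMap_eq_one {v : Valuation K Γ} (hv : ∀ c : k, v (algebraMap k K c) ≤ 1)
    {c : k} (hc : c ≠ 0) : v (algebraMap k K c) = 1 := by
  refine le_antisymm (hv c) ?_
  have h : v (algebraMap k K c) * v (algebraMap k K c⁻¹) = 1 := by
    rw [← map_mul, ← map_mul, mul_inv_cancel₀ hc, map_one, map_one]
  calc (1 : Γ) = v (algebraMap k K c) * v (algebraMap k K c⁻¹) := h.symm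
    _ ≤ v (algebraMap k K c) * 1 := mul_le_mul_right (hv _) _
    _ = _ := mul_one _

lemma map_aeval_le {v : Valuation K Γ} (hv : ∀ c : k, v (algebraMap k K c) ≤ 1) {x : K}
    (hx : 1 < v x) (p : k[X]) : v (aeval x p) ≤ v x ^ p.natDegree := by
  rw [aeval_eq_sum_range]
  refine v.map_sum_le fun i hi => ?_
  rw [Algebra.smul_def, map_mul, map_pow]
  exact (mul_le_of_le_one_left' (hv _)).trans
    (pow_le_pow_right₀ hx.le (Nat.lt_succ_iff.1 (Finset.mem_range.1 hi)))

lemma map_aeval_eq {v : Valuation K Γ} (hv : ∀ c : k, v (algebraMap k K c) ≤ 1) {x : K}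
    (hx : 1 < v x) {p : k[X]} (hp : p ≠ 0) : v (aeval x p) = v x ^ p.natDegree := by
  have hx0 : v x ≠ 0 := (zero_lt_one.trans hx).ne'
  rw [aeval_eq_sum_range, Finset.sum_range_succ]
  have hlead : v (p.coeff p.natDegree • x ^ p.natDegree) = v x ^ p.natDegree := by
    rw [Algebra.smul_def, map_mul, map_pow, map_algebraMap_eq_one hv (c := p.coeff p.natDegree) (leadingCoeff_ne_zero.2 hp),
      one_mul]
  rw [v.map_add_eq_of_lt_right, hlead]
  rw [hlead]
  refine v.map_sum_lt (pow_ne_zero _ hx0) fun i hi => ?_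
  rw [Algebra.smul_def, map_mul, map_pow]
  exact (mul_le_of_le_one_left' (hv _)).trans_lt
    (pow_lt_pow_right₀ hx (Finset.mem_range.1 hi))

/-- The exponent does not depend on the valuation: at every pole of `x`, the function `f` has the
order of a fixed power of `x`. -/
lemma exists_map_eq_zpow_of_mem_adjoin {x f : K} (hf : f ∈ k⟮x⟯) (hf0 : f ≠ 0) :
    ∃ e : ℤ, ∀ {Γ : Type*} [LinearOrderedCommGroupWithZero Γ] (v : Valuation K Γ),
      (∀ c : k, v (algebraMap k K c) ≤ 1) → 1 < v x → v f = v x ^ e := by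
  obtain ⟨r, s, rfl⟩ := (mem_adjoin_simple_iff k f).1 hf
  have hr : r ≠ 0 := by rintro rfl; simp at hf0
  have hs : s ≠ 0 := by rintro rfl; simp at hf0
  refine ⟨r.natDegree - s.natDegree, fun v hv hx => ?_⟩
  have hx0 : v x ≠ 0 := (zero_lt_one.trans hx).ne'
  rw [map_div₀, map_aeval_eq hv hx hr, map_aeval_eq hv hx hs, zpow_sub₀ hx0, zpow_natCast,
    zpow_natCast]

lemma transcendental_of_one_lt {v : Valuation K Γ} (hv : ∀ c : k, v (algebraMap k K c) ≤ 1) {x : K}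
    (hx : 1 < v x) : Transcendental k x := by
  rintro ⟨p, hp, h⟩
  have := map_aeval_eq hv hx hp
  rw [h, map_zero] at this
  exact pow_ne_zero _ (zero_lt_one.trans hx).ne' this.symm

end Valuations

variable {k : Type u} {K : Type w} [Field k] [Field K] [Algebra k K]

lemma IsCurveFunctionField.finiteDimensional_adjoin (hK : IsCurveFunctionField k K) {x : K}
    (hx : Transcendental k x) : FiniteDimensional k⟮x⟯ K := by
  have hind : AlgebraicIndependent k (fun _ : Unit => x) :=
    algebraicIndependent_unique_type_iff.2 hx
  have hbasis : IsTranscendenceBasis k (fun _ : Unit => x) :=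
    AlgebraicIndependent.isTranscendenceBasis_of_lift_trdeg_le_of_finite hind (by
      simp [hK.trdeg_eq_one])
  have halg : Algebra.IsAlgebraic k⟮x⟯ K := by
    have := hbasis.isAlgebraic_field
    rwa [Set.range_const] at this
  have : Algebra.EssFiniteType k K := fg_top_iff.1 hK.fg
  have : Algebra.EssFiniteType k⟮x⟯ K := Algebra.EssFiniteType.of_comp k k⟮x⟯ K
  obtain ⟨s, hs⟩ := IntermediateField.fg_top k⟮x⟯ K
  have hfin : FiniteDimensional k⟮x⟯ (adjoin k⟮x⟯ (s : Set K)) :=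
    IntermediateField.finiteDimensional_adjoin fun y _ => (halg.isAlgebraic y).isIntegral
  rw [hs] at hfin
  exact IntermediateField.topEquiv.toLinearEquiv.finiteDimensional

/-! ### Weak approximation and finiteness of the set of poles -/

namespace Place

lemma mem_ring_iff (P : Place k K) {x : K} : x ∈ P.ring ↔ P.valuation x ≤ 1 := by
  refine ⟨valuation_le_one, fun h => ?_⟩
  by_contra hx
  have hx0 : x ≠ 0 := by rintro rfl; exact hx P.ring.zero_mem
  have hinv : x⁻¹ ∈ P.ring := (P.ring.mem_or_inv_mem x).resolve_left hx
  have hmem : (⟨x⁻¹, hinv⟩ : P.ring) ∈ IsLocalRing.maximalIdeal P.ring := by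
    rw [IsLocalRing.mem_maximalIdeal, mem_nonunits_iff]
    intro hu
    obtain ⟨y, hy⟩ := hu.exists_right_inv
    have hy' : x⁻¹ * (y : K) = 1 := congrArg Subtype.val hy
    have : (y : K) = x := by
      rw [← mul_one x, ← hy', mul_inv_cancel_left₀ hx0]
    exact hx (this ▸ y.2)
  have hlt : P.valuation x⁻¹ < 1 :=
    ((IsDiscreteValuationRing.maximalIdeal P.ring).valuation_lt_one_iff_mem (K := K)
      ⟨x⁻¹, hinv⟩).2 hmem
  exact absurd ((P.valuation.val_lt_one_iff (inv_ne_zero hx0)).1 hlt) (by simpa using h)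

lemma map_algebraMap_le (P : Place k K) (c : k) : P.valuation (algebraMap k K c) ≤ 1 :=
  valuation_le_one (P.algebraMap_mem c)

lemma valuation_surjective (P : Place k K) (n : ℤ) : ∃ x, P.valuation x = WithZero.exp n :=
  (IsDiscreteValuationRing.maximalIdeal P.ring).valuation_surjective K _

lemma exists_pow_mul_lt_one (P : Place k K) {z : K} (hz : P.valuation z < 1) (y : K) :
    ∃ N, ∀ n ≥ N, P.valuation (z ^ n * y) < 1 := by
  by_cases hy : y = 0
  · exact ⟨0, fun n _ => by simp [hy]⟩
  have hy' : P.valuation y ≠ 0 := (Valuation.ne_zero_iff _).2 hy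
  obtain ⟨N, hN⟩ := exists_pow_lt₀ hz (Units.mk0 _ hy')⁻¹
  refine ⟨N, fun n hn => ?_⟩
  rw [map_mul, map_pow]
  have h1 : P.valuation z ^ n < (P.valuation y)⁻¹ :=
    (pow_le_pow_right_of_le_one' hz.le hn).trans_lt (by simpa using hN)
  calc _ < (P.valuation y)⁻¹ * P.valuation y := by
        exact mul_lt_mul_of_pos_right h1 (zero_lt_iff.2 hy')
    _ = 1 := inv_mul_cancel₀ hy'

/-- There are no inclusions between the valuation rings of distinct places: `P.ring` together with
a single element outside of it generates all of `K`. -/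
lemma eq_of_ring_le {P P' : Place k K} (h : P.ring ≤ P'.ring) : P = P' := by
  refine Place.ext (le_antisymm h fun x hx => ?_)
  by_contra hxP
  rw [P.mem_ring_iff, not_le] at hxP
  have hx0 : x ≠ 0 := by rintro rfl; simp at hxP
  obtain ⟨y, hy⟩ := P'.valuation_surjective 1
  obtain ⟨N, hN⟩ := P.exists_pow_mul_lt_one ((P.valuation.one_lt_val_iff hx0).1 hxP) y
  have h1 : x⁻¹ ^ N * y ∈ P'.ring := h (P.mem_ring_iff.2 (hN N le_rfl).le)
  have h2 : y ∈ P'.ring := by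
    have := P'.ring.mul_mem _ _ (pow_mem hx N) h1
    rwa [← mul_assoc, ← mul_pow, mul_inv_cancel₀ hx0, one_pow, one_mul] at this
  rw [P'.mem_ring_iff, hy, ← WithZero.exp_zero, WithZero.exp_le_exp] at h2
  omega

lemma exists_one_lt_of_ne {P P' : Place k K} (h : P ≠ P') :
    ∃ z, 1 < P.valuation z ∧ P'.valuation z < 1 := by
  have h1 : ¬ P'.ring ≤ P.ring := fun hle => h (eq_of_ring_le hle).symm
  have h2 : ¬ P.ring ≤ P'.ring := fun hle => h (eq_of_ring_le hle)
  obtain ⟨a, ha, ha'⟩ := SetLike.not_le_iff_exists.1 h1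
  obtain ⟨b, hb, hb'⟩ := SetLike.not_le_iff_exists.1 h2
  rw [mem_ring_iff] at ha hb
  rw [mem_ring_iff, not_le] at ha' hb'
  refine ⟨a / b, ?_, ?_⟩
  · rw [map_div₀, one_lt_div₀]
    · exact hb.trans_lt ha'
    · refine (Valuation.pos_iff _).2 ?_
      rintro rfl; simp at hb'
  · rw [map_div₀, div_lt_one₀ (zero_lt_one.trans hb')]
    exact ha.trans_lt hb'

lemma map_one_add_pow {P : Place k K} {z : K} (hz : 1 < P.valuation z) {n : ℕ} (hn : n ≠ 0) :
    P.valuation (1 + z ^ n) = P.valuation z ^ n := by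
  rw [Valuation.map_add_eq_of_lt_right, map_pow]
  rw [map_one, map_pow]
  exact one_lt_pow₀ hz hn

lemma map_one_add_pow_of_lt {P : Place k K} {z : K} (hz : P.valuation z < 1) {n : ℕ} (hn : n ≠ 0) :
    P.valuation (1 + z ^ n) = 1 := by
  refine Valuation.map_one_add_of_lt _ ?_
  rw [map_pow]
  exact pow_lt_one₀ zero_le hz hn

/-- The multiplier `z ^ n / (1 + z ^ n)` of the approximation arguments is a unit at the poles of `z`,
and vanishes to the same order as `z ^ n` at the zeros of `z` (`map_pow_div_of_lt_one`). -/
lemma map_pow_div_of_one_lt {P : Place k K} {z : K} (hz : 1 < P.valuation z) {n : ℕ} (hn : n ≠ 0) :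
    P.valuation (z ^ n / (1 + z ^ n)) = 1 := by
  rw [map_div₀, map_one_add_pow hz hn, map_pow, div_self]
  exact pow_ne_zero _ (zero_lt_one.trans hz).ne'

lemma map_pow_div_of_lt_one {P : Place k K} {z : K} (hz : P.valuation z < 1) {n : ℕ} (hn : n ≠ 0) :
    P.valuation (z ^ n / (1 + z ^ n)) = P.valuation (z ^ n) := by
  rw [map_div₀, map_one_add_pow_of_lt hz hn, div_one]

lemma exists_one_lt_forall_lt_one (T : Finset (Place k K)) {P : Place k K} (hP : P ∉ T) :
    ∃ z, 1 < P.valuation z ∧ ∀ P' ∈ T, P'.valuation z < 1 := by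
  classical
  induction T using Finset.induction_on with
  | empty =>
    obtain ⟨z, hz⟩ := P.valuation_surjective 1
    refine ⟨z, ?_, by simp⟩
    rw [hz, ← WithZero.exp_zero, WithZero.exp_lt_exp]
    exact one_pos
  | insert R T hR ih =>
    rw [Finset.mem_insert, not_or] at hP
    obtain ⟨z, hzP, hzT⟩ := ih hP.2
    obtain ⟨w, hwP, hwR⟩ := exists_one_lt_of_ne hP.1
    have hN : ∃ N, ∀ n ≥ N, ∀ P' ∈ T, P'.valuation (z ^ n * w) < 1 := by
      choose! N hN using fun P' hP' => exists_pow_mul_lt_one P' (hzT P' hP') w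
      exact ⟨T.sup N, fun n hn P' hP' => hN P' hP' n ((Finset.le_sup hP').trans hn)⟩
    obtain ⟨N, hN⟩ := hN
    rcases le_or_gt (R.valuation z) 1 with hzR | hzR
    · refine ⟨z ^ N * w, ?_, ?_⟩
      · rw [map_mul, map_pow]
        exact hwP.trans_le (le_mul_of_one_le_left' (one_le_pow₀ hzP.le))
      · intro P' hP'
        rcases Finset.mem_insert.1 hP' with rfl | hP'
        · rw [map_mul, map_pow]
          exact (mul_le_of_le_one_left' (pow_le_one₀ zero_le hzR)).trans_lt hwR
        · exact hN N le_rfl P' hP'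
    · refine ⟨z ^ (N + 1) / (1 + z ^ (N + 1)) * w, ?_, ?_⟩
      · rwa [map_mul, map_pow_div_of_one_lt hzP N.succ_ne_zero, one_mul]
      · intro P' hP'
        rcases Finset.mem_insert.1 hP' with rfl | hP'
        · rwa [map_mul, map_pow_div_of_one_lt hzR N.succ_ne_zero, one_mul]
        · rw [map_mul, map_pow_div_of_lt_one (hzT P' hP') N.succ_ne_zero, ← map_mul]
          exact hN _ (Nat.le_succ N) P' hP'

/-- Weak approximation with one prescribed principal part: `y` can be changed, without changing its
principal part at `P`, so that it becomes regular at the finitely many other places in `T`. -/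
lemma exists_approx (T : Finset (Place k K)) {P : Place k K} (hP : P ∉ T) (y : K) :
    ∃ y', P.valuation (y' - y) ≤ 1 ∧ ∀ P' ∈ T, P'.valuation y' ≤ 1 := by
  classical
  obtain ⟨z, hzP, hzT⟩ := exists_one_lt_forall_lt_one T hP
  have hN : ∃ N, ∀ n ≥ N, ∀ P' ∈ T, P'.valuation (z ^ n * y) < 1 := by
    choose! N hN using fun P' hP' => exists_pow_mul_lt_one P' (hzT P' hP') y
    exact ⟨T.sup N, fun n hn P' hP' => hN P' hP' n ((Finset.le_sup hP').trans hn)⟩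
  obtain ⟨N, hN⟩ := hN
  have hz0 : z ≠ 0 := by rintro rfl; simp at hzP
  obtain ⟨N', hN'⟩ := exists_pow_mul_lt_one P ((P.valuation.one_lt_val_iff hz0).1 hzP) y
  set n := N + N' + 1 with hn
  have hn0 : n ≠ 0 := by omega
  refine ⟨z ^ n / (1 + z ^ n) * y, ?_, fun P' hP' => ?_⟩
  · have h1 : (1 + z ^ n : K) ≠ 0 := by
      refine (Valuation.ne_zero_iff P.valuation).1 ?_
      rw [map_one_add_pow hzP hn0]
      exact pow_ne_zero _ (zero_lt_one.trans hzP).ne'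
    have h2 : z ^ n / (1 + z ^ n) * y - y = -(y / (1 + z ^ n)) := by
      field_simp; ring
    have h3 := hN' n (by omega)
    rw [map_mul, map_pow, map_inv₀] at h3
    rw [h2, Valuation.map_neg, map_div₀, map_one_add_pow hzP hn0, div_eq_mul_inv, mul_comm,
      ← inv_pow]
    exact h3.le
  · rw [map_mul, map_pow_div_of_lt_one (hzT P' hP') hn0, ← map_mul]
    exact (hN _ (by omega) P' hP').le

end Place

lemma sum_ne_zero_of_forall_lt {ι Γ : Type*} [Fintype ι] [LinearOrderedCommGroupWithZero Γ]
    (v : Valuation K Γ) (g : ι → K) (j : ι) (hj : g j ≠ 0) (h : ∀ i ≠ j, v (g i) < v (g j)) :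
    ∑ i, g i ≠ 0 := by
  classical
  intro h0
  have h1 := v.map_sum_eq_of_lt (s := Finset.univ) (f := g) (j := j) (Finset.mem_univ j)
    (fun i hi => h i (by simpa using hi))
  rw [h0, map_zero] at h1
  exact (Valuation.ne_zero_iff _).2 hj h1.symm

/-- The places at which `x` has a pole are finitely many, since functions that single out distinct
poles of `x` are linearly independent over `k(x)`. -/
lemma finite_poles (hK : IsCurveFunctionField k K) (x : K) :
    {P : Place k K | 1 < P.valuation x}.Finite := by
  classical
  by_contra hinf
  obtain ⟨P₀, hP₀⟩ := Set.Infinite.nonempty hinf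
  have hfin := hK.finiteDimensional_adjoin (transcendental_of_one_lt P₀.map_algebraMap_le hP₀)
  obtain ⟨T, hT, hcard⟩ := Set.Infinite.exists_subset_card_eq hinf (Module.finrank k⟮x⟯ K + 1)
  choose z hz1 hz2 using fun P : T => Place.exists_one_lt_forall_lt_one (T.erase P.1)
    (P := P.1) (by simp)
  have hli : LinearIndependent k⟮x⟯ z := by
    rw [Fintype.linearIndependent_iff]
    intro g hg
    by_contra! hne
    choose! e he using fun P : T => fun hP : g P ≠ 0 =>
      exists_map_eq_zpow_of_mem_adjoin.{u, w, 0} (k := k) (x := x) (g P).2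
        (by simpa using hP)
    obtain ⟨P, hP, hmax⟩ := Finset.exists_max_image (Finset.univ.filter fun P => g P ≠ 0) e
      (by obtain ⟨P, hP⟩ := hne; exact ⟨P, by simpa using hP⟩)
    simp only [Finset.mem_filter, Finset.mem_univ, true_and] at hP hmax
    have hPx : 1 < P.1.valuation x := hT P.2
    have hz0 : z P ≠ 0 := by
      intro h; have := hz1 P; simp [h] at this
    refine sum_ne_zero_of_forall_lt P.1.valuation (fun i => g i • z i) P ?_ ?_ hg
    · exact smul_ne_zero hP hz0
    · intro P' hne'
      have hpos : 0 < P.1.valuation (g P • z P) :=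
        (Valuation.pos_iff _).2 (smul_ne_zero hP hz0)
      by_cases hP' : g P' = 0
      · simpa [hP'] using hpos
      simp only [IntermediateField.smul_def, smul_eq_mul, map_mul]
      rw [he P hP _ P.1.map_algebraMap_le hPx, he P' hP' _ P.1.map_algebraMap_le hPx]
      have hzlt : P.1.valuation (z P') < 1 :=
        hz2 P' P.1 (Finset.mem_erase.2 ⟨fun h => hne' (Subtype.ext h.symm), P.2⟩)
      have hx0 : 0 < P.1.valuation x := zero_lt_one.trans hPx
      calc P.1.valuation x ^ e P' * P.1.valuation (z P')
          < P.1.valuation x ^ e P' * 1 := by gcongr; exact zpow_pos hx0 _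
        _ ≤ P.1.valuation x ^ e P * 1 := by gcongr; exacts [hPx.le, hmax P' hP']
        _ ≤ _ := by gcongr; exact (hz1 P).le
  have := hli.fintype_card_le_finrank
  simp [hcard] at this

/-! ### Existence of poles -/

section Existence

variable {O : ValuationSubring K}

/-- Elements of pairwise distinct value in `[1, v(x))` are linearly independent over `k(x)`, because
all nonzero elements of `k(x)` have value a power of `v(x)`. -/
lemma finite_values (hK : IsCurveFunctionField k K) (hO : ∀ a : k, algebraMap k K a ∈ O)
    {x : K} (hx : 1 < O.valuation x) :
    {γ | 1 ≤ γ ∧ γ < O.valuation x ∧ ∃ b, O.valuation b = γ}.Finite := by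
  classical
  by_contra hinf
  have hv : ∀ c : k, O.valuation (algebraMap k K c) ≤ 1 := fun c =>
    (O.valuation_le_one_iff _).2 (hO c)
  have hfin := hK.finiteDimensional_adjoin (transcendental_of_one_lt hv hx)
  obtain ⟨T, hT, hcard⟩ := Set.Infinite.exists_subset_card_eq hinf (Module.finrank k⟮x⟯ K + 1)
  choose b hb using fun γ : T => (hT γ.2).2.2
  have hx0 : 0 < O.valuation x := zero_lt_one.trans hx
  have hli : LinearIndependent k⟮x⟯ b := by
    rw [Fintype.linearIndependent_iff]
    intro g hg
    by_contra! hne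
    choose! e he using fun P : T => fun hP : g P ≠ 0 =>
      exists_map_eq_zpow_of_mem_adjoin.{u, w, w} (k := k) (x := x) (g P).2
        (by simpa using hP)
    obtain ⟨P, hP, hmax⟩ := Finset.exists_max_image (Finset.univ.filter fun P => g P ≠ 0)
      (fun P => O.valuation x ^ e P * O.valuation (b P))
      (by obtain ⟨P, hP⟩ := hne; exact ⟨P, by simpa using hP⟩)
    simp only [Finset.mem_filter, Finset.mem_univ, true_and] at hP hmax
    have hb0 : b P ≠ 0 := by
      intro h
      have := (hT P.2).1
      rw [← hb P, h, map_zero] at this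
      exact absurd this (by simp)
    refine sum_ne_zero_of_forall_lt O.valuation (fun i => g i • b i) P ?_ ?_ hg
    · exact smul_ne_zero hP hb0
    · intro P' hne'
      have hpos : 0 < O.valuation (g P • b P) :=
        (Valuation.pos_iff _).2 (smul_ne_zero hP hb0)
      by_cases hP' : g P' = 0
      · simpa [hP'] using hpos
      simp only [IntermediateField.smul_def, smul_eq_mul, map_mul]
      rw [he P hP _ hv hx, he P' hP' _ hv hx]
      refine lt_of_le_of_ne (hmax P' hP') fun heq => hne' (Subtype.ext ?_)
      rw [hb, hb] at heq
      have key : ∀ {γ γ' : O.ValueGroup} {a a' : ℤ}, 1 ≤ γ → γ' < O.valuation x →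
          O.valuation x ^ a * γ = O.valuation x ^ a' * γ' → a ≤ a' := by
        intro γ γ' a a' h1 h2 h3
        by_contra! hlt
        have h4 : O.valuation x ^ a' * γ' < O.valuation x ^ (a' + 1) := by
          rw [zpow_add₀ hx0.ne', zpow_one]
          exact mul_lt_mul_of_pos_left h2 (zpow_pos hx0 _)
        have h5 : O.valuation x ^ (a' + 1) ≤ O.valuation x ^ a * γ :=
          (zpow_le_zpow_right₀ hx.le hlt).trans (le_mul_of_one_le_right' h1)
        exact absurd (h4.trans_le h5) (by rw [h3]; exact lt_irrefl _)
      have hee : e P' = e P := le_antisymm (key (hT P'.2).1 (hT P.2).2.1 heq)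
        (key (hT P.2).1 (hT P'.2).2.1 heq.symm)
      rw [hee] at heq
      exact mul_left_cancel₀ (zpow_ne_zero _ hx0.ne') heq
  have := hli.fintype_card_le_finrank
  simp [hcard] at this

/-- A nontrivial valuation ring of a function field in one variable that contains the constants is
discrete. -/
lemma isDiscreteValuationRing_of_valuationSubring (hK : IsCurveFunctionField k K)
    (hO : ∀ a : k, algebraMap k K a ∈ O) {x : K} (hx : x ∉ O) : IsDiscreteValuationRing O := by
  have hx1 : 1 < O.valuation x := by rwa [← not_le, O.valuation_le_one_iff]
  have hx0 : x ≠ 0 := by rintro rfl; exact hx O.zero_mem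
  have hpir : IsPrincipalIdealRing O := by
    refine ⟨fun I => ?_⟩
    by_cases hI : I = ⊥
    · rw [hI]; infer_instance
    obtain ⟨a, haI, ha0⟩ := Submodule.exists_mem_ne_zero_of_ne_bot hI
    have ha0' : (a : K) ≠ 0 := by simpa using ha0
    -- Some element of `I` has maximal value; only finitely many values lie between `v(a)` and `1`.
    obtain ⟨b, hbI, hb⟩ : ∃ b ∈ I, ∀ c ∈ I, O.valuation c ≤ O.valuation b := by
      by_cases hex : ∃ c ∈ I, O.valuation a < O.valuation c
      swap
      · push Not at hex
        exact ⟨a, haI, hex⟩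
      obtain ⟨c, hcI, hac⟩ := hex
      have hc1 : O.valuation c ≤ 1 := (O.valuation_le_one_iff _).2 c.2
      have hainv : 1 < O.valuation (a : K)⁻¹ :=
        (Valuation.val_lt_one_iff _ ha0').1 (hac.trans_le hc1)
      have hfin := (finite_values hK hO hainv).image (fun γ => γ⁻¹)
      have hfin2 : {γ | O.valuation a < γ ∧ ∃ c ∈ I, O.valuation (c : K) = γ}.Finite := by
        refine hfin.subset ?_
        rintro _ ⟨h1, d, hd, rfl⟩
        have hd0 : 0 < O.valuation (d : K) := ((Valuation.pos_iff _).2 ha0').trans h1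
        refine ⟨(O.valuation (d : K))⁻¹, ⟨?_, ?_, (d : K)⁻¹, by simp⟩, inv_inv _⟩
        · exact (one_le_inv₀ hd0).2 ((O.valuation_le_one_iff _).2 d.2)
        · rw [map_inv₀]
          exact (inv_lt_inv₀ hd0 ((Valuation.pos_iff _).2 ha0')).2 h1
      obtain ⟨_, ⟨hlt, d, hd, rfl⟩, hmax⟩ := Set.exists_max_image _ id hfin2 ⟨_, hac, c, hcI, rfl⟩
      refine ⟨d, hd, fun e he => ?_⟩
      by_cases h : O.valuation a < O.valuation e
      · exact hmax _ ⟨h, e, he, rfl⟩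
      · exact (not_lt.1 h).trans hlt.le
    have hb0 : (b : K) ≠ 0 := by
      intro h
      have := hb a haI
      rw [h, map_zero, le_zero_iff, Valuation.zero_iff] at this
      exact ha0' this
    refine ⟨b, le_antisymm (fun c hc => ?_) ?_⟩
    · rw [Submodule.mem_span_singleton]
      have hcb : (c : K) / b ∈ O := by
        rw [← O.valuation_le_one_iff, map_div₀]
        exact (div_le_one₀ ((Valuation.pos_iff _).2 hb0)).2 (hb c hc)
      exact ⟨⟨_, hcb⟩, Subtype.ext (div_mul_cancel₀ _ hb0)⟩
    · simpa [Submodule.span_le] using hbI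
  refine { hpir with not_a_field' := fun h => ?_ }
  have hinv : x⁻¹ ∈ O := (O.mem_or_inv_mem x).resolve_left hx
  have hmem : (⟨x⁻¹, hinv⟩ : O) ∈ IsLocalRing.maximalIdeal O := by
    rw [O.valuation_lt_one_iff]
    exact (Valuation.one_lt_val_iff _ hx0).1 hx1
  rw [h, Ideal.mem_bot] at hmem
  exact inv_ne_zero hx0 (congrArg Subtype.val hmem)

/-- A function without poles is constant. -/
lemma isAlgebraic_of_forall_mem (hK : IsCurveFunctionField k K) {x : K}
    (hx : ∀ P : Place k K, x ∈ P.ring) : IsAlgebraic k x := by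
  have hmem : x ∈ (integralClosure (Subring.closure (Set.range (algebraMap k K))) K).toSubring := by
    rw [← iInf_valuationSubring_superset, Subring.mem_iInf]
    rintro ⟨O, hO⟩
    by_contra hxO
    have hO' : ∀ a : k, algebraMap k K a ∈ O := fun a => hO ⟨a, rfl⟩
    exact hxO (hx ⟨O, hO', isDiscreteValuationRing_of_valuationSubring hK hO' hxO⟩)
  have hcl : Subring.closure (Set.range (algebraMap k K)) = (algebraMap k K).range := by
    rw [← RingHom.coe_range, Subring.closure_eq]
  rw [hcl] at hmem
  obtain ⟨p, hp, hpx⟩ : IsIntegral (algebraMap k K).range x := hmem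
  obtain ⟨q, hq, -, hqm⟩ := Polynomial.lifts_and_natDegree_eq_and_monic
    (f := (algebraMap k K).rangeRestrict)
    (p := p) (by
      rw [Polynomial.lifts_iff_coeff_lifts]
      exact fun n => (algebraMap k K).rangeRestrict_surjective _) hp
  refine ⟨q, hqm.ne_zero, ?_⟩
  rw [← hq, Polynomial.eval₂_map] at hpx
  rw [Polynomial.aeval_def]
  exact hpx

end Existence

/-! ### Finite dimension of Riemann-Roch spaces -/

section RiemannRoch

lemma mem_riemannRoch {D : Divisor k K} {f : K} :
    f ∈ riemannRoch D ↔ ∀ P : Place k K, P.valuation f ≤ WithZero.exp (D P) :=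
  mem_riemannRoch_iff D f

lemma riemannRoch_mono {D D' : Divisor k K} (h : D ≤ D') : riemannRoch D ≤ riemannRoch D' :=
  fun _ hf => mem_riemannRoch.2 fun P =>
    (mem_riemannRoch.1 hf P).trans (WithZero.exp_le_exp.2 (h P))

/-- At a rational place, a constant multiple of `h` cancels the leading term of `f`. -/
lemma Place.IsRational.exists_sub_smul_lt {P : Place k K} (hP : P.IsRational) {f h : K}
    (hh : h ≠ 0) (hfh : P.valuation f ≤ P.valuation h) :
    ∃ a : k, P.valuation (f - a • h) < P.valuation h := by
  have hpos : 0 < P.valuation h := (Valuation.pos_iff _).2 hh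
  have hmem : f / h ∈ P.ring := by
    rw [P.mem_ring_iff, map_div₀]
    exact (div_le_one₀ hpos).2 hfh
  obtain ⟨a, ha⟩ := hP ⟨_, hmem⟩
  refine ⟨a, ?_⟩
  rw [← sub_eq_zero, ← map_sub, IsLocalRing.residue_eq_zero_iff] at ha
  have hlt : P.valuation (f / h - algebraMap k K a) < 1 :=
    ((IsDiscreteValuationRing.maximalIdeal P.ring).valuation_lt_one_iff_mem (K := K) _).2 ha
  have heq : f - a • h = (f / h - algebraMap k K a) * h := by
    rw [Algebra.smul_def]; field_simp
  rw [heq, map_mul]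
  calc _ < 1 * P.valuation h := mul_lt_mul_of_pos_right hlt hpos
    _ = _ := one_mul _

lemma finiteDimensional_riemannRoch_zero (hK : IsCurveFunctionField k K) :
    FiniteDimensional k (riemannRoch (0 : Divisor k K)) := by
  have hle : riemannRoch (0 : Divisor k K) ≤ k ∙ (1 : K) := by
    intro f hf
    have halg := isAlgebraic_of_forall_mem hK (x := f) fun P => by
      simpa [P.mem_ring_iff] using mem_riemannRoch.1 hf P
    have hbot : f ∈ (⊥ : IntermediateField k K) := by
      rw [← hK.constants]
      exact mem_algebraicClosure_iff.2 halg
    obtain ⟨c, rfl⟩ := IntermediateField.mem_bot.1 hbot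
    exact Submodule.mem_span_singleton.2 ⟨c, (Algebra.algebraMap_eq_smul_one c).symm⟩
  exact Submodule.finiteDimensional_of_le hle

lemma finiteDimensional_riemannRoch_add_single {D : Divisor k K} {P : Place k K}
    (hP : P.IsRational) (hD : FiniteDimensional k (riemannRoch D)) :
    FiniteDimensional k (riemannRoch (D + Finsupp.single P 1)) := by
  classical
  have key : ∀ f ∈ riemannRoch (D + Finsupp.single P 1),
      P.valuation f ≤ WithZero.exp (D P) → f ∈ riemannRoch D := by
    intro f hf hfP
    refine mem_riemannRoch.2 fun P' => ?_
    by_cases h : P' = P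
    · rwa [h]
    · simpa [Finsupp.single_apply, Ne.symm h] using mem_riemannRoch.1 hf P'
  by_cases hex : ∃ h ∈ riemannRoch (D + Finsupp.single P 1), WithZero.exp (D P) < P.valuation h
  · obtain ⟨h, hh, hlt⟩ := hex
    have hh0 : h ≠ 0 := by rintro rfl; simp at hlt
    have hval : P.valuation h = WithZero.exp (D P + 1) := by
      refine le_antisymm (by simpa using mem_riemannRoch.1 hh P) ?_
      have h0 : P.valuation h ≠ 0 := (Valuation.ne_zero_iff _).2 hh0
      rw [← WithZero.exp_log h0, WithZero.exp_lt_exp] at hlt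
      rw [← WithZero.exp_log h0, WithZero.exp_le_exp]
      omega
    have hle : riemannRoch (D + Finsupp.single P 1) ≤ riemannRoch D ⊔ k ∙ h := by
      intro f hf
      have hfP : P.valuation f ≤ P.valuation h := by
        rw [hval]; simpa using mem_riemannRoch.1 hf P
      obtain ⟨a, ha⟩ := hP.exists_sub_smul_lt hh0 hfP
      have hmem : f - a • h ∈ riemannRoch D := by
        refine key _ (Submodule.sub_mem _ hf (Submodule.smul_mem _ _ hh)) ?_
        by_cases h0 : P.valuation (f - a • h) = 0
        · simp [h0]
        · rw [hval, ← WithZero.exp_log h0, WithZero.exp_lt_exp] at ha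
          rw [← WithZero.exp_log h0, WithZero.exp_le_exp]
          omega
      rw [← sub_add_cancel f (a • h)]
      exact Submodule.add_mem_sup hmem (Submodule.smul_mem _ _ (Submodule.mem_span_singleton_self h))
    exact Submodule.finiteDimensional_of_le hle
  · push Not at hex
    exact Submodule.finiteDimensional_of_le fun f hf => key f hf (hex f hf)

lemma finiteDimensional_riemannRoch_add_single_nat {D : Divisor k K} {P : Place k K}
    (hP : P.IsRational) (hD : FiniteDimensional k (riemannRoch D)) (n : ℕ) :
    FiniteDimensional k (riemannRoch (D + Finsupp.single P (n : ℤ))) := by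
  induction n with
  | zero =>
    rw [Nat.cast_zero, Finsupp.single_zero, add_zero]
    exact hD
  | succ n ih =>
    have := finiteDimensional_riemannRoch_add_single hP ih
    rwa [add_assoc, ← Finsupp.single_add, ← Nat.cast_succ] at this

lemma finiteDimensional_riemannRoch_tupleDivisor (hK : IsCurveFunctionField k K) {m : ℕ}
    {Q : Fin m → Place k K} (hrat : ∀ i, (Q i).IsRational) (α : Fin m → ℤ) :
    FiniteDimensional k (riemannRoch (tupleDivisor Q α)) := by
  classical
  have hnat : ∀ s : Finset (Fin m),
      FiniteDimensional k (riemannRoch (∑ i ∈ s, Finsupp.single (Q i) ((α i).toNat : ℤ))) := by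
    intro s
    induction s using Finset.induction_on with
    | empty =>
      rw [Finset.sum_empty]
      exact finiteDimensional_riemannRoch_zero hK
    | insert i s hi ih =>
      rw [Finset.sum_insert hi, add_comm]
      exact finiteDimensional_riemannRoch_add_single_nat (hrat i) ih _
  have := hnat Finset.univ
  have hle : tupleDivisor Q α ≤ ∑ i, Finsupp.single (Q i) ((α i).toNat : ℤ) :=
    Finset.sum_le_sum fun i _ => Finsupp.single_le_single.2 (Int.self_le_toNat _)
  exact Submodule.finiteDimensional_of_le (riemannRoch_mono hle)

end RiemannRoch

/-! ### Strong approximation -/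

section Regular

/-- The space of the functions that are regular at all places in `S`. -/
def regularOn (S : Set (Place k K)) : Submodule k K where
  carrier := {f | ∀ P ∈ S, P.valuation f ≤ 1}
  zero_mem' := fun P _ => by simp
  add_mem' := fun hf hg P hP => P.valuation.map_add_le (hf P hP) (hg P hP)
  smul_mem' := fun c f hf P hP => by
    rw [Algebra.smul_def, map_mul]
    exact (mul_le_of_le_one_left' (P.map_algebraMap_le c)).trans (hf P hP)

lemma mul_mem_regularOn {S : Set (Place k K)} {f g : K} (hf : f ∈ regularOn S)
    (hg : g ∈ regularOn S) : f * g ∈ regularOn S := fun P hP => by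
  rw [map_mul]
  exact mul_le_one' (hf P hP) (hg P hP)

lemma regularOn_anti {S T : Set (Place k K)} (h : S ⊆ T) :
    (regularOn T : Submodule k K) ≤ regularOn S :=
  fun _ hf P hP => hf P (h hP)

lemma pow_mem_regularOn {S : Set (Place k K)} {f : K} (hf : f ∈ regularOn S) (n : ℕ) :
    f ^ n ∈ regularOn S := fun P hP => by
  rw [map_pow]
  exact pow_le_one₀ zero_le (hf P hP)

lemma mem_regularOn_of_isIntegral {x y : K} (hy : IsIntegral (Algebra.adjoin k {x}) y) :
    y ∈ regularOn {P : Place k K | P.valuation x ≤ 1} := by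
  intro P hP
  have hle : (Algebra.adjoin k {x}).toSubring ≤ P.ring.toSubring := by
    intro z hz
    refine Algebra.adjoin_induction (p := fun z _ => z ∈ P.ring) ?_ ?_ ?_ ?_ hz
    · rintro _ rfl; exact P.mem_ring_iff.2 hP
    · exact P.algebraMap_mem
    · exact fun _ _ _ _ => P.ring.add_mem _ _
    · exact fun _ _ _ _ => P.ring.mul_mem _ _
  obtain ⟨p, hp, hpy⟩ := hy
  have hint : IsIntegral P.ring y := by
    refine ⟨p.map (Subring.inclusion hle), hp.map _, ?_⟩
    rw [Polynomial.eval₂_map]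
    exact hpy
  obtain ⟨z, hz⟩ := IsIntegrallyClosed.isIntegral_iff.1 hint
  rw [← P.mem_ring_iff, ← hz]
  exact z.2

open scoped algebraAdjoinAdjoin in
lemma exists_spanning_regularOn {x : K} [FiniteDimensional k⟮x⟯ K] :
    ∃ (n : ℕ) (b : Fin n → K), (∀ j, b j ∈ regularOn {P : Place k K | P.valuation x ≤ 1}) ∧
      ∀ y : K, ∃ c : Fin n → k⟮x⟯, y = ∑ j, c j • b j := by
  let b := Module.finBasis k⟮x⟯ K
  have hex : ∀ j, ∃ d : Algebra.adjoin k {x}, d ≠ 0 ∧ IsIntegral (Algebra.adjoin k {x}) (d • b j) := by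
    intro j
    have halg : IsAlgebraic k⟮x⟯ (b j) := Algebra.IsAlgebraic.isAlgebraic _
    have halg' : IsAlgebraic (Algebra.adjoin k {x}) (b j) :=
      (IsFractionRing.isAlgebraic_iff (Algebra.adjoin k {x}) k⟮x⟯ K).2 halg
    exact halg'.exists_integral_multiple
  choose d hd hint using hex
  refine ⟨_, fun j => d j • b j, fun j => mem_regularOn_of_isIntegral (hint j), fun y => ?_⟩
  have hmem : ∀ j, (d j : K) ∈ k⟮x⟯ := fun j => algebra_adjoin_le_adjoin k {x} (d j).2
  refine ⟨fun j => b.repr y j / ⟨d j, hmem j⟩, ?_⟩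
  conv_lhs => rw [← b.sum_repr y]
  refine Finset.sum_congr rfl fun j _ => ?_
  have hd0 : (d j : K) ≠ 0 := by simpa using hd j
  simp only [IntermediateField.smul_def, Subalgebra.smul_def, smul_eq_mul,
    IntermediateField.coe_div]
  field_simp

/-- An element of `k(x)` is a polynomial in `x` plus a function regular at the poles of `x`: divide
the numerator by the denominator with remainder. -/
lemma exists_aeval_add_regularOn {x : K} (f : k⟮x⟯) :
    ∃ d : k[X], ∃ g ∈ regularOn {P : Place k K | 1 < P.valuation x}, (f : K) = aeval x d + g := by
  obtain ⟨r, s, hf⟩ := (mem_adjoin_simple_iff k (f : K)).1 f.2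
  by_cases hs : aeval x s = 0
  · exact ⟨0, 0, Submodule.zero_mem _, by simp [hf, hs]⟩
  have hs0 : s ≠ 0 := by rintro rfl; simp at hs
  refine ⟨r / s, aeval x (r % s) / aeval x s, fun P hP => ?_, ?_⟩
  · have hP' : 1 < P.valuation x := hP
    have hpos : 0 < P.valuation x := zero_lt_one.trans hP'
    rw [map_div₀, map_aeval_eq P.map_algebraMap_le hP' hs0]
    refine (div_le_one₀ (pow_pos hpos _)).2 ?_
    refine (map_aeval_le P.map_algebraMap_le hP' _).trans ?_
    exact pow_le_pow_right₀ hP'.le (natDegree_le_natDegree (degree_mod_lt r hs0).le)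
  · rw [hf]
    conv_lhs => rw [← EuclideanDomain.div_add_mod r s]
    rw [map_add, map_mul]
    field_simp

/-- Finiteness of the first cohomology of the structure sheaf, for the covering of the curve by the
places where `x` is regular and a neighbourhood of the poles of `x`. Both spaces contain a lattice
with respect to a basis of `K` over `k(x)`, so the claim reduces to the projective line. -/
lemma finiteDimensional_quotient_regularOn_sup (hK : IsCurveFunctionField k K) {x : K}
    (hx : Transcendental k x) :
    FiniteDimensional k (K ⧸ (regularOn {P : Place k K | P.valuation x ≤ 1} ⊔
      regularOn {P : Place k K | 1 < P.valuation x})) := by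
  classical
  have := hK.finiteDimensional_adjoin hx
  obtain ⟨n, b, hb, hspan⟩ := exists_spanning_regularOn (k := k) (x := x)
  have hx0 : x ≠ 0 := by rintro rfl; exact hx isAlgebraic_zero
  obtain ⟨e, he⟩ : ∃ e, ∀ j, x⁻¹ ^ e * b j ∈ regularOn {P : Place k K | 1 < P.valuation x} := by
    have hN : ∀ P ∈ (finite_poles hK x).toFinset, ∃ N, ∀ l ≥ N, ∀ j,
        P.valuation (x⁻¹ ^ l * b j) < 1 := by
      intro P hP
      have hP' : 1 < P.valuation x := by simpa using hP
      choose N hN using fun j => Place.exists_pow_mul_lt_one P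
        ((P.valuation.one_lt_val_iff hx0).1 hP') (b j)
      exact ⟨Finset.univ.sup N, fun l hl j => hN j l ((Finset.le_sup (Finset.mem_univ j)).trans hl)⟩
    choose! N hN using hN
    refine ⟨(finite_poles hK x).toFinset.sup N, fun j P hP => ?_⟩
    have hP' : P ∈ (finite_poles hK x).toFinset := by simpa using hP
    exact (hN P hP' _ (Finset.le_sup hP') j).le
  set A : Submodule k K := regularOn {P : Place k K | P.valuation x ≤ 1}
  set B : Submodule k K := regularOn {P : Place k K | 1 < P.valuation x}
  let E : Submodule k K :=
    Submodule.span k (Set.range fun p : Fin e × Fin n => x ^ (p.1 : ℕ) * (x⁻¹ ^ e * b p.2))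
  have hE : FiniteDimensional k E := FiniteDimensional.span_of_finite k (Set.finite_range _)
  have htop : ∀ y : K, y ∈ A ⊔ B ⊔ E := by
    intro y
    obtain ⟨c, rfl⟩ := hspan y
    refine Submodule.sum_mem _ fun j _ => ?_
    have hxmem : x ∈ k⟮x⟯ := mem_adjoin_simple_self k x
    obtain ⟨d, g, hg, hdg⟩ := exists_aeval_add_regularOn (c j * ⟨x, hxmem⟩ ^ e)
    have hcj : c j • b j = aeval x d * (x⁻¹ ^ e * b j) + g * (x⁻¹ ^ e * b j) := by
      have hone : x ^ e * x⁻¹ ^ e = 1 := by rw [← mul_pow, mul_inv_cancel₀ hx0, one_pow]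
      rw [← add_mul, ← hdg, IntermediateField.smul_def, smul_eq_mul]
      push_cast
      rw [mul_assoc, ← mul_assoc (x ^ e), hone, one_mul]
    rw [hcj]
    refine Submodule.add_mem _ ?_ ?_
    · rw [aeval_eq_sum_range, Finset.sum_mul]
      refine Submodule.sum_mem _ fun l _ => ?_
      rw [smul_mul_assoc]
      refine Submodule.smul_mem _ _ ?_
      by_cases hl : l < e
      · exact Submodule.mem_sup_right (Submodule.subset_span ⟨(⟨l, hl⟩, j), rfl⟩)
      · have heq : x ^ l * (x⁻¹ ^ e * b j) = x ^ (l - e) * b j := by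
          rw [← mul_assoc, inv_pow, pow_sub₀ x hx0 (not_lt.1 hl)]
        rw [heq]
        exact Submodule.mem_sup_left (Submodule.mem_sup_left
          (mul_mem_regularOn (pow_mem_regularOn (fun P hP => hP) _) (hb j)))
    · exact Submodule.mem_sup_left (Submodule.mem_sup_right (mul_mem_regularOn hg (he j)))
  refine Module.Finite.of_surjective ((A ⊔ B).mkQ.comp E.subtype) fun z => ?_
  obtain ⟨y, rfl⟩ := Submodule.mkQ_surjective _ z
  obtain ⟨a, ha, t, ht, rfl⟩ := Submodule.mem_sup.1 (htop y)
  refine ⟨⟨t, ht⟩, ?_⟩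
  have : (A ⊔ B).mkQ a = 0 := by simpa using ha
  rw [map_add, this, zero_add]
  rfl

/-- Finiteness for one place: only finitely many linear conditions decide whether a principal part
at `P` is that of a function that is regular elsewhere. -/
lemma finiteDimensional_quotient_regularOn_place (hK : IsCurveFunctionField k K)
    (P : Place k K) :
    FiniteDimensional k (K ⧸ (regularOn {P}ᶜ ⊔ regularOn {P} : Submodule k K)) := by
  classical
  obtain ⟨x, hx⟩ := P.valuation_surjective 1
  have hx1 : 1 < P.valuation x := by
    rw [hx, ← WithZero.exp_zero, WithZero.exp_lt_exp]; exact one_pos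
  have hfin := finiteDimensional_quotient_regularOn_sup hK
    (transcendental_of_one_lt P.map_algebraMap_le hx1)
  set V : Submodule k K := regularOn {P : Place k K | P.valuation x ≤ 1} ⊔
      regularOn {P : Place k K | 1 < P.valuation x}
  set U : Submodule k K := regularOn {P}ᶜ ⊔ regularOn {P}
  let Y : Submodule k K := regularOn ({P' : Place k K | 1 < P'.valuation x} \ {P})
  let φ : Y →ₗ[k] K ⧸ V := V.mkQ.comp Y.subtype
  let ψ : Y →ₗ[k] K ⧸ U := U.mkQ.comp Y.subtype
  have hψ : Function.Surjective ψ := by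
    intro z
    obtain ⟨y, rfl⟩ := Submodule.mkQ_surjective _ z
    obtain ⟨y', hy', hreg⟩ := Place.exists_approx ((finite_poles hK x).toFinset.erase P)
      (P := P) (by simp) y
    refine ⟨⟨y', fun P' hP' => hreg P' ?_⟩, ?_⟩
    · simpa [and_comm] using hP'
    · refine (Submodule.Quotient.eq U).2 (Submodule.mem_sup_right ?_)
      rintro _ rfl
      exact hy'
  have hker : LinearMap.ker φ ≤ LinearMap.ker ψ := by
    rintro ⟨y, hy⟩ hyV
    have hyV' : y ∈ V := by simpa [φ] using hyV
    have : y ∈ U := by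
      obtain ⟨a, ha, b, hb, rfl⟩ := Submodule.mem_sup.1 hyV'
      refine Submodule.add_mem_sup (fun P' hP' => ?_) (fun P' hP' => ?_)
      · rcases le_or_gt (P'.valuation x) 1 with h | h
        · exact ha P' h
        · rw [← add_sub_cancel_right a b]
          exact P'.valuation.map_sub_le (hy P' ⟨h, hP'⟩) (hb P' h)
      · rw [Set.mem_singleton_iff] at hP'
        exact hb P' (by rw [hP']; exact hx1)
    simpa [ψ] using this
  have hfinY : FiniteDimensional k (Y ⧸ LinearMap.ker φ) :=
    Module.Finite.of_injective _ (LinearMap.ker_eq_bot.1 (Submodule.ker_liftQ_eq_bot' _ φ rfl))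
  refine Module.Finite.of_surjective ((LinearMap.ker φ).liftQ ψ hker) ?_
  rw [← LinearMap.range_eq_top, Submodule.range_liftQ, LinearMap.range_eq_top]
  exact hψ

/-- A subspace of finite codimension in `K` that is stable under multiplication by a transcendental
element `f` is all of `K`: for some `p ≠ 0`, multiplication by `p(f)` kills the quotient, but it
is onto. -/
lemma eq_top_of_finiteDimensional_quotient {U : Submodule k K} [FiniteDimensional k (K ⧸ U)]
    {f : K} (hf : Transcendental k f) (hU : ∀ u ∈ U, f * u ∈ U) : U = ⊤ := by
  let φ : Module.End k (K ⧸ U) := U.mapQ U (LinearMap.mulLeft k f) hU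
  have haeval : ∀ (p : k[X]) (y : K), aeval φ p (U.mkQ y) = U.mkQ (aeval f p * y) := by
    intro p
    induction p using Polynomial.induction_on' with
    | add p q hp hq => intro y; simp only [map_add, LinearMap.add_apply, hp, hq, add_mul]
    | monomial n a =>
      intro y
      have hpow : (φ ^ n) (U.mkQ y) = U.mkQ (f ^ n * y) := by
        induction n with
        | zero => simp
        | succ n ih =>
          rw [pow_succ', Module.End.mul_apply, ih, pow_succ', mul_assoc]
          rfl
      rw [aeval_monomial, aeval_monomial, Module.End.mul_apply, hpow,
        Module.algebraMap_end_apply, ← Algebra.smul_def, smul_mul_assoc, map_smul]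
  obtain ⟨p, hp, hp0⟩ := (Algebra.IsIntegral.isIntegral (R := k) φ).isAlgebraic
  have hpf : aeval f p ≠ 0 := fun h => hf ⟨p, hp, h⟩
  rw [eq_top_iff]
  intro y _
  have h := haeval p ((aeval f p)⁻¹ * y)
  rw [hp0, mul_inv_cancel_left₀ hpf, LinearMap.zero_apply] at h
  simpa using h.symm

/-- Every place is the only pole of some function. -/
lemma exists_unique_pole (hK : IsCurveFunctionField k K) (P : Place k K) :
    ∃ f ∈ regularOn ({P}ᶜ : Set (Place k K)), 1 < P.valuation f := by
  by_contra! hno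
  have hfin := finiteDimensional_quotient_regularOn_place hK P
  have hle : (regularOn {P}ᶜ : Submodule k K) ≤ regularOn {P} := by
    rintro f hf _ rfl
    exact hno f hf
  rw [sup_eq_right.2 hle] at hfin
  obtain ⟨t, ht⟩ := P.valuation_surjective (-1)
  obtain ⟨x, hx⟩ := P.valuation_surjective 1
  have hx1 : 1 < P.valuation x := by
    rw [hx, ← WithZero.exp_zero, WithZero.exp_lt_exp]; exact one_pos
  have ht1 : P.valuation t < 1 := by
    rw [ht, ← WithZero.exp_zero, WithZero.exp_lt_exp]; norm_num
  have ht0 : t ≠ 0 := by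
    rintro rfl
    rw [map_zero] at ht
    exact WithZero.exp_ne_zero ht.symm
  have htr : Transcendental k t := by
    intro halg
    exact transcendental_of_one_lt P.map_algebraMap_le ((Valuation.val_lt_one_iff _ ht0).1 ht1)
      halg.inv
  have htop := eq_top_of_finiteDimensional_quotient (U := regularOn {P}) htr fun u hu =>
    mul_mem_regularOn (by rintro _ rfl; exact ht1.le) hu
  exact absurd ((htop ▸ Submodule.mem_top : x ∈ regularOn {P}) P rfl) hx1.not_ge

/-- Strong approximation at `P`, with poles allowed at one further place `S`: every principal part
at `P` belongs to a function that is regular outside `{P, S}`. -/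
lemma exists_strong_approx (hK : IsCurveFunctionField k K) {P S : Place k K} (hPS : P ≠ S) (y : K) :
    ∃ h ∈ regularOn ({P, S}ᶜ : Set (Place k K)), P.valuation (h - y) ≤ 1 := by
  obtain ⟨f, hf, hfS⟩ := exists_unique_pole hK S
  have hfin : FiniteDimensional k (K ⧸ (regularOn {P, S}ᶜ ⊔ regularOn {P} : Submodule k K)) := by
    have := finiteDimensional_quotient_regularOn_place hK P
    have hle : (regularOn {P}ᶜ ⊔ regularOn {P} : Submodule k K) ≤
        regularOn {P, S}ᶜ ⊔ regularOn {P} :=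
      sup_le_sup_right (regularOn_anti (Set.compl_subset_compl.2 (by simp))) _
    exact Module.Finite.of_surjective _ (Submodule.factor_surjective hle)
  have htop := eq_top_of_finiteDimensional_quotient
    (transcendental_of_one_lt S.map_algebraMap_le hfS) (U := regularOn {P, S}ᶜ ⊔ regularOn {P}) (by
      intro u hu
      obtain ⟨a, ha, b, hb, rfl⟩ := Submodule.mem_sup.1 hu
      rw [mul_add]
      refine Submodule.add_mem_sup (mul_mem_regularOn (regularOn_anti ?_ hf) ha)
        (mul_mem_regularOn (regularOn_anti ?_ hf) hb)
      · exact Set.compl_subset_compl.2 (by simp)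
      · simpa using hPS.symm)
  obtain ⟨h, hh, o, ho, hy⟩ := Submodule.mem_sup.1 (htop ▸ Submodule.mem_top : y ∈ _)
  refine ⟨h, hh, ?_⟩
  rw [← hy, sub_add_cancel_left, Valuation.map_neg]
  exact ho P rfl

end Regular

/-! ### Functionals modelled on residues -/

variable {m : ℕ}

section ResidueForms

lemma lt_exp_add_one_iff {x : ℤᵐ⁰} {n : ℤ} : x < WithZero.exp (n + 1) ↔ x ≤ WithZero.exp n := by
  by_cases hx : x = 0
  · simp [hx]
  rw [← WithZero.exp_log hx, WithZero.exp_lt_exp, WithZero.exp_le_exp, Int.lt_add_one_iff]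

lemma Place.map_smul_of_ne_zero (P : Place k K) {c : k} (hc : c ≠ 0) (x : K) :
    P.valuation (c • x) = P.valuation x := by
  rw [Algebra.smul_def, map_mul, map_algebraMap_eq_one P.map_algebraMap_le hc, one_mul]

lemma Place.valuation_eq_exp {P : Place k K} {h : K} (hh : h ≠ 0) :
    P.valuation h = WithZero.exp (-P.ord h) := by
  rw [Place.ord, neg_neg, WithZero.exp_log ((Valuation.ne_zero_iff _).2 hh)]

/-- The families `(λ₁, …, λ_m)` of linear functionals on `K` that vanish, in sum, on the functions
regular outside `{Q₁, …, Q_m}`, and such that `λ_s` vanishes on the functions with a pole of order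
less than `γ_s` at `Q_s`. The families `λ_s(x) = Res_{Q_s}(x ω)` are of this kind, where `ω` is a
differential, regular outside `{Q₁, …, Q_m}` and with order at least `γ_s - 1` at `Q_s`. -/
def residueForms (Q : Fin m → Place k K) (γ : Fin m → ℤ) :
    Submodule k (Fin m → Module.Dual k K) where
  carrier := {μ | (∀ h ∈ regularOn (k := k) (Set.range Q)ᶜ, ∑ s, μ s h = 0) ∧
    ∀ s x, (Q s).valuation x < WithZero.exp (γ s) → μ s x = 0}
  zero_mem' := by simp
  add_mem' := by
    rintro μ ν ⟨h1, h2⟩ ⟨h3, h4⟩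
    refine ⟨fun h hh => ?_, fun s x hx => ?_⟩
    · simp [Finset.sum_add_distrib, h1 h hh, h3 h hh]
    · simp [h2 s x hx, h4 s x hx]
  smul_mem' := by
    rintro c μ ⟨h1, h2⟩
    refine ⟨fun h hh => ?_, fun s x hx => ?_⟩
    · simp [← Finset.mul_sum, h1 h hh]
    · simp [h2 s x hx]

variable {Q : Fin m → Place k K} {γ : Fin m → ℤ}

/-- Duality: a system of principal parts that is not realized, up to lower order terms, by a
function regular outside `{Q₁, …, Q_m}` is detected by a residue form. -/
lemma exists_residueForm_ne_zero {x : Fin m → K}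
    (hx : ¬ ∃ h ∈ regularOn (k := k) (Set.range Q)ᶜ,
      ∀ s, (Q s).valuation (x s - h) < WithZero.exp (γ s)) :
    ∃ μ ∈ residueForms Q γ, ∑ s, μ s (x s) ≠ 0 := by
  classical
  let W : Submodule k (Fin m → K) :=
    { carrier := {y | ∃ h ∈ regularOn (k := k) (Set.range Q)ᶜ,
        ∀ s, (Q s).valuation (y s - h) < WithZero.exp (γ s)}
      zero_mem' := ⟨0, Submodule.zero_mem _, fun s => by simp⟩
      add_mem' := by
        rintro y z ⟨a, ha, ha'⟩ ⟨b, hb, hb'⟩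
        refine ⟨a + b, Submodule.add_mem _ ha hb, fun s => ?_⟩
        rw [Pi.add_apply, add_sub_add_comm]
        exact Valuation.map_add_lt _ (ha' s) (hb' s)
      smul_mem' := by
        rintro c y ⟨a, ha, ha'⟩
        refine ⟨c • a, Submodule.smul_mem _ _ ha, fun s => ?_⟩
        rw [Pi.smul_apply, ← smul_sub, Algebra.smul_def, map_mul]
        exact (mul_le_of_le_one_left' ((Q s).map_algebraMap_le c)).trans_lt (ha' s) }
  obtain ⟨f, hf, hW⟩ := Submodule.exists_le_ker_of_notMem (p := W) (v := x) hx
  have hsum : ∀ y : Fin m → K, ∑ s, (f.comp (LinearMap.single k (fun _ => K) s)) (y s) = f y := by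
    intro y
    conv_rhs => rw [← Finset.univ_sum_single y]
    rw [map_sum]
    rfl
  refine ⟨fun s => f.comp (LinearMap.single k (fun _ => K) s), ⟨fun h hh => ?_, fun s y hy => ?_⟩, ?_⟩
  · rw [hsum fun _ => h]
    exact hW ⟨h, hh, fun s => by simp⟩
  · refine hW ⟨0, Submodule.zero_mem _, fun t => ?_⟩
    rw [LinearMap.single_apply, sub_zero]
    by_cases hts : t = s
    · subst hts; simpa using hy
    · simp [Pi.single_eq_of_ne hts]
  · rwa [hsum]

lemma residueForms_apply_eq_zero {μ : Fin m → Module.Dual k K} (hμ : μ ∈ residueForms Q γ)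
    {s : Fin m} (hs : (Q s).IsRational) {z : K} (hz : (Q s).valuation z = WithZero.exp (γ s))
    (hμz : μ s z = 0) {x : K} (hx : (Q s).valuation x ≤ WithZero.exp (γ s)) : μ s x = 0 := by
  have hz0 : z ≠ 0 := by
    rintro rfl
    rw [map_zero] at hz
    exact WithZero.exp_ne_zero hz.symm
  obtain ⟨a, ha⟩ := hs.exists_sub_smul_lt hz0 (hx.trans hz.ge)
  have := hμ.2 s _ (ha.trans_eq hz)
  simpa [hμz] using this

lemma mem_residueForms_update {μ : Fin m → Module.Dual k K} (hμ : μ ∈ residueForms Q γ)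
    {s : Fin m} (hs : ∀ x, (Q s).valuation x ≤ WithZero.exp (γ s) → μ s x = 0) :
    μ ∈ residueForms Q (Function.update γ s (γ s + 1)) := by
  refine ⟨hμ.1, fun t x hx => ?_⟩
  by_cases hts : t = s
  · subst hts
    rw [Function.update_self, lt_exp_add_one_iff] at hx
    exact hs x hx
  · rw [Function.update_of_ne hts] at hx
    exact hμ.2 t x hx

end ResidueForms

/-! ### Relative maximal tuples -/

/-- A field with at least `|J| ≥ 2` elements contains `|J|` nonzero elements with sum zero. -/
lemma exists_sum_eq_zero_support (hfin : Finite k) {J : Finset (Fin m)} (hJ : 2 ≤ J.card)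
    (hJk : J.card ≤ Nat.card k) : ∃ c : Fin m → k, ∑ j, c j = 0 ∧ ∀ j, c j ≠ 0 ↔ j ∈ J := by
  classical
  obtain ⟨j₁, h₁, j₂, h₂, hne⟩ := Finset.one_lt_card.1 hJ
  -- Start from the indicator function of `J` and correct it by `a` at `j₁` and `-a - |J|` at `j₂`.
  obtain ⟨a, ha1, ha2⟩ : ∃ a : k, a + 1 ≠ 0 ∧ -a - (J.card : k) + 1 ≠ 0 := by
    rcases hJ.eq_or_lt with h | h
    · refine ⟨0, by simp, ?_⟩
      rw [← h]
      norm_num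
    · have := Fintype.ofFinite k
      rw [Nat.card_eq_fintype_card] at hJk
      have hlt : ({-1, 1 - (J.card : k)} : Finset k).card < (Finset.univ : Finset k).card :=
        Finset.card_le_two.trans_lt (by rw [Finset.card_univ]; omega)
      obtain ⟨a, -, ha⟩ := Finset.exists_mem_notMem_of_card_lt_card hlt
      simp only [Finset.mem_insert, Finset.mem_singleton, not_or] at ha
      refine ⟨a, fun h => ha.1 (eq_neg_of_add_eq_zero_left h), fun h => ha.2 ?_⟩
      linear_combination -h
  refine ⟨fun j => (Pi.single j₁ a : Fin m → k) j + (Pi.single j₂ (-a - (J.card : k)) : Fin m → k) j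
    + if j ∈ J then 1 else 0, ?_, fun j => ?_⟩
  · simp [Finset.sum_add_distrib, Finset.sum_pi_single']
    ring
  · by_cases hj1 : j = j₁
    · subst hj1
      simpa [h₁, Pi.single_eq_of_ne hne] using ha1
    by_cases hj2 : j = j₂
    · subst hj2
      simpa [h₂, Pi.single_eq_of_ne hj1] using ha2
    · simp [hj1, hj2]

section RelativeMaximal

variable {Q : Fin m → Place k K}

lemma regularOutside_eq (Q : Fin m → Place k K) :
    regularOutside Q = (regularOn (Set.range Q)ᶜ : Submodule k K) := by
  ext h
  exact forall₂_congr fun P _ => P.mem_ring_iff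

lemma mem_nabla_of_valuation {J : Finset (Fin m)} {γ : Fin m → ℤ} {h : K} (h0 : h ≠ 0)
    (hh : h ∈ regularOn (k := k) (Set.range Q)ᶜ)
    (hJ : ∀ j ∈ J, (Q j).valuation h = WithZero.exp (γ j))
    (hJ' : ∀ j ∉ J, (Q j).valuation h < WithZero.exp (γ j)) :
    (fun j => -(Q j).ord h) ∈ nabla Q J γ := by
  refine ⟨⟨fun j hj => ?_, fun j hj => ?_⟩, h, ?_, h0, fun _ => rfl⟩
  · have := hJ j hj
    rwa [Place.valuation_eq_exp h0, WithZero.exp_inj] at this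
  · have := hJ' j hj
    rwa [Place.valuation_eq_exp h0, WithZero.exp_lt_exp] at this
  · rw [regularOutside_eq]
    exact hh

/-- A relative maximal tuple arises as the tuple of conductors of a residue form none of whose
components can be made less singular. For such a form the leading coefficients at the `Q_s` of the
functions with poles bounded by `γ` fill a hyperplane that contains no coordinate axis. -/
lemma mem_relMaximals_of_maximal (hfin : Finite k) (hm : 2 ≤ m) (hq : m ≤ Nat.card k)
    (hrat : ∀ i, (Q i).IsRational) {γ : Fin m → ℤ} {μ : Fin m → Module.Dual k K}
    (hμ : μ ∈ residueForms Q γ) {z : Fin m → K}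
    (hz : ∀ s, (Q s).valuation (z s) = WithZero.exp (γ s)) (hμz : ∀ s, μ s (z s) = 1) (i : Fin m)
    (hmax : ∀ ν ∈ residueForms Q γ, ν i (z i) = 1 → ∀ s, ν s (z s) ≠ 0) :
    γ ∈ relMaximals Q := by
  have hreal : ∀ c : Fin m → k, ∑ j, c j = 0 → ∃ h ∈ regularOn (k := k) (Set.range Q)ᶜ,
      ∀ s, (Q s).valuation (c s • z s - h) < WithZero.exp (γ s) := by
    intro c hc
    by_contra hno
    obtain ⟨ν, hν, hne⟩ := exists_residueForm_ne_zero (x := fun s => c s • z s) hno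
    -- Subtracting a multiple of `μ` makes the leading coefficient of `ν` at `Q i` vanish, but not
    -- all the others; then a further combination with `μ` contradicts maximality.
    let ν' := ν - ν i (z i) • μ
    have hν' : ν' ∈ residueForms Q γ := Submodule.sub_mem _ hν (Submodule.smul_mem _ _ hμ)
    have hν'i : ν' i (z i) = 0 := by simp [ν', hμz]
    have hsum : ∑ s, c s * ν' s (z s) ≠ 0 := by
      have : ∑ s, c s * ν' s (z s) = ∑ s, ν s (c s • z s) - ν i (z i) * ∑ s, c s := by
        rw [Finset.mul_sum, ← Finset.sum_sub_distrib]
        refine Finset.sum_congr rfl fun s _ => ?_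
        simp only [ν', Pi.sub_apply, Pi.smul_apply, LinearMap.sub_apply, LinearMap.smul_apply,
          hμz, map_smul, smul_eq_mul]
        ring
      rw [this, hc, mul_zero, sub_zero]
      exact hne
    obtain ⟨s, -, hs⟩ := Finset.exists_ne_zero_of_sum_ne_zero hsum
    have hs' : ν' s (z s) ≠ 0 := right_ne_zero_of_mul hs
    refine hmax (μ - (ν' s (z s))⁻¹ • ν')
      (Submodule.sub_mem _ hμ (Submodule.smul_mem _ _ hν')) ?_ s ?_
    · simp [hμz, hν'i]
    · simp [hμz, hs']
  have hnabla : ∀ J : Finset (Fin m), 2 ≤ J.card → (nabla Q J γ).Nonempty := by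
    intro J hJ
    obtain ⟨c, hc, hcJ⟩ := exists_sum_eq_zero_support hfin hJ
      ((J.card_le_univ.trans_eq (Fintype.card_fin m)).trans hq)
    obtain ⟨h, hh, hlt⟩ := hreal c hc
    have hval : ∀ j ∈ J, (Q j).valuation h = WithZero.exp (γ j) := by
      intro j hj
      have h1 : (Q j).valuation (c j • z j) = WithZero.exp (γ j) := by
        rw [(Q j).map_smul_of_ne_zero ((hcJ j).2 hj), hz]
      rw [← h1]
      refine Valuation.map_eq_of_sub_lt _ ?_
      rw [Valuation.map_sub_swap, h1]
      exact hlt j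
    obtain ⟨j, hj⟩ : J.Nonempty := Finset.card_pos.1 (by omega)
    have h0 : h ≠ 0 := by
      rintro rfl
      have := hval j hj
      rw [map_zero] at this
      exact WithZero.exp_ne_zero this.symm
    refine ⟨_, mem_nabla_of_valuation h0 hh hval fun j hj => ?_⟩
    have hcj : c j = 0 := by
      by_contra hne
      exact hj ((hcJ j).1 hne)
    have := hlt j
    rwa [hcj, zero_smul, zero_sub, Valuation.map_neg] at this
  refine ⟨⟨?_, ?_⟩, fun J _ hJ => hnabla J hJ⟩
  · obtain ⟨β, hβ, hβQ⟩ := hnabla Finset.univ (by simpa using hm)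
    have : β = γ := funext fun j => hβ.1 j (Finset.mem_univ j)
    rwa [this] at hβQ
  · rw [Set.eq_empty_iff_forall_notMem]
    rintro β ⟨hβ, h, hh, h0, hβh⟩
    obtain ⟨j, hj, hj'⟩ := Set.mem_iUnion.1 hβ
    rw [regularOutside_eq] at hh
    have hval : ∀ s, (Q s).valuation h = WithZero.exp (β s) := fun s => by
      rw [Place.valuation_eq_exp h0, hβh]
    have hother : ∀ s ≠ j, μ s h = 0 := by
      intro s hs
      refine hμ.2 s h ?_
      rw [hval, WithZero.exp_lt_exp]
      exact hj' s (by simpa using hs)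
    have hjh : μ j h = 0 := by
      have := hμ.1 h hh
      rwa [Finset.sum_eq_single j (fun s _ hs => hother s hs) (by simp)] at this
    have hβj : β j = γ j := hj j (by simp)
    have := residueForms_apply_eq_zero hμ (hrat j) (by rw [hval, hβj]) hjh (hz j).le
    rw [hμz] at this
    exact one_ne_zero this

/-- Functions with a pole of prescribed order at `Q i`, and elsewhere a pole only at `Q s`. -/
lemma exists_pole_order (hK : IsCurveFunctionField k K) (hQ : Function.Injective Q) {i s : Fin m}
    (hsi : s ≠ i) {n : ℤ} (hn : 0 ≤ n) :
    ∃ h ∈ regularOn (k := k) (Set.range Q)ᶜ, (Q i).valuation h = WithZero.exp n ∧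
      ∀ t ≠ i, t ≠ s → (Q t).valuation h ≤ 1 := by
  rcases hn.eq_or_lt with rfl | hpos
  · exact ⟨1, fun P _ => by simp, by simp, fun t _ _ => by simp⟩
  obtain ⟨y, hy⟩ := (Q i).valuation_surjective n
  obtain ⟨h, hh, hhy⟩ := exists_strong_approx hK (hQ.ne hsi.symm) y
  refine ⟨h, regularOn_anti ?_ hh, ?_, fun t hti hts => hh _ ?_⟩
  · rw [Set.compl_subset_compl, Set.insert_subset_iff, Set.singleton_subset_iff]
    exact ⟨⟨i, rfl⟩, ⟨s, rfl⟩⟩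
  · rw [← hy]
    refine Valuation.map_eq_of_sub_lt _ (hhy.trans_lt ?_)
    rw [hy, ← WithZero.exp_zero, WithZero.exp_lt_exp]
    exact hpos
  · simp [hQ.eq_iff, hti, hts]

lemma exists_relMaximal (hK : IsCurveFunctionField k K) (hfin : Finite k) (hm : 2 ≤ m)
    (hq : m ≤ Nat.card k) (hQ : Function.Injective Q) (hrat : ∀ i, (Q i).IsRational)
    {α : Fin m → ℤ} (hα : 0 ≤ α) {i : Fin m}
    (hi : ¬ ∃ h ∈ regularOn (k := k) (Set.range Q)ᶜ, (Q i).valuation h = WithZero.exp (α i) ∧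
      ∀ s, (Q s).valuation h ≤ WithZero.exp (α s)) :
    ∃ γ ∈ relMaximals Q, γ i = α i ∧ ∀ s ≠ i, α s < γ s := by
  classical
  obtain ⟨y, hy⟩ := (Q i).valuation_surjective (α i)
  let Γ : Set (Fin m → ℤ) := {γ | γ i = α i ∧ (∀ s ≠ i, α s < γ s) ∧
    ∃ μ ∈ residueForms Q γ, μ i y ≠ 0}
  have hne : Γ.Nonempty := by
    let γ₀ : Fin m → ℤ := Function.update (fun s => α s + 1) i (α i)
    obtain ⟨μ, hμ, hμy⟩ := exists_residueForm_ne_zero (Q := Q) (γ := γ₀) (x := Pi.single i y) (by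
      rintro ⟨h, hh, hlt⟩
      have hhi : (Q i).valuation h = WithZero.exp (α i) := by
        rw [← hy]
        refine Valuation.map_eq_of_sub_lt _ ?_
        rw [Valuation.map_sub_swap, hy]
        simpa [γ₀] using hlt i
      refine hi ⟨h, hh, hhi, fun s => ?_⟩
      by_cases hs : s = i
      · rw [hs, hhi]
      · have := hlt s
        rwa [Pi.single_eq_of_ne hs, zero_sub, Valuation.map_neg,
          show γ₀ s = α s + 1 from Function.update_of_ne hs _ _, lt_exp_add_one_iff] at this)
    refine ⟨γ₀, by simp [γ₀], fun s hs => by simp [γ₀, hs], μ, hμ, ?_⟩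
    rwa [Finset.sum_eq_single i (fun s _ hs => by simp [Pi.single_eq_of_ne hs]) (by simp),
      Pi.single_eq_same] at hμy
  have hbound : ∀ s, ∃ b : ℤ, ∀ γ ∈ Γ, γ s ≤ b := by
    intro s
    by_cases hs : s = i
    · exact ⟨α i, fun γ hγ => by rw [hs, hγ.1]⟩
    obtain ⟨h, hh, hhi, hht⟩ := exists_pole_order hK hQ hs (hα i)
    have h0 : h ≠ 0 := by
      rintro rfl
      rw [map_zero] at hhi
      exact WithZero.exp_ne_zero hhi.symm
    refine ⟨-(Q s).ord h, fun γ hγ => ?_⟩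
    obtain ⟨hγi, hγα, μ, hμ, hμy⟩ := hγ
    by_contra! hlt
    have hother : ∀ t ≠ i, μ t h = 0 := by
      intro t ht
      refine hμ.2 t h ?_
      by_cases hts : t = s
      · rwa [hts, Place.valuation_eq_exp h0, WithZero.exp_lt_exp]
      · refine (hht t ht hts).trans_lt ?_
        rw [← WithZero.exp_zero, WithZero.exp_lt_exp]
        exact (hα t).trans_lt (hγα t ht)
    have hih : μ i h = 0 := by
      have := hμ.1 h hh
      rwa [Finset.sum_eq_single i (fun t _ ht => hother t ht) (by simp)] at this
    exact hμy (residueForms_apply_eq_zero hμ (hrat i) (by rw [hhi, hγi]) hih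
      (by rw [hy, hγi]))
  choose b hb using hbound
  have hΓfin : Γ.Finite := (Set.finite_Icc α b).subset fun γ hγ =>
    ⟨fun s => by
      by_cases hs : s = i
      · rw [hs, hγ.1]
      · exact (hγ.2.1 s hs).le, fun s => hb s γ hγ⟩
  obtain ⟨γ, hγ, hmax⟩ := hΓfin.exists_maximal hne
  obtain ⟨hγi, hγα, μ, hμ, hμy⟩ := hγ
  -- By maximality, no form that is nonzero at `y` can be less singular at some `Q s`.
  have hnz : ∀ ν ∈ residueForms Q γ, ν i y ≠ 0 → ∀ s x, (Q s).valuation x = WithZero.exp (γ s) →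
      ν s x ≠ 0 := by
    intro ν hν hνy s x hx hνx
    have hvan : ∀ x', (Q s).valuation x' ≤ WithZero.exp (γ s) → ν s x' = 0 :=
      fun x' hx' => residueForms_apply_eq_zero hν (hrat s) hx hνx hx'
    by_cases hs : s = i
    · subst hs
      exact hνy (hvan y (by rw [hy, hγi]))
    · have hup : Function.update γ s (γ s + 1) ∈ Γ := by
        refine ⟨by rwa [Function.update_of_ne (Ne.symm hs)], fun t ht => ?_, ν,
          mem_residueForms_update hν hvan, hνy⟩
        by_cases hts : t = s
        · subst hts
          rw [Function.update_self]
          exact (hγα t ht).trans (lt_add_one _)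
        · rw [Function.update_of_ne hts]
          exact hγα t ht
      have hle : γ ≤ Function.update γ s (γ s + 1) :=
        le_update_iff.2 ⟨(lt_add_one _).le, fun _ _ => le_rfl⟩
      have : Function.update γ s (γ s + 1) s ≤ γ s := hmax hup hle s
      rw [Function.update_self] at this
      omega
  choose x hx using fun s => (Q s).valuation_surjective (γ s)
  refine ⟨γ, mem_relMaximals_of_maximal hfin hm hq hrat hμ (z := fun s => (μ s (x s))⁻¹ • x s)
    (fun s => ?_) (fun s => ?_) i (fun ν hν hνi s => ?_), hγi, hγα⟩
  · rw [(Q s).map_smul_of_ne_zero (inv_ne_zero (hnz μ hμ hμy s _ (hx s))), hx]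
  · rw [map_smul, smul_eq_mul, inv_mul_cancel₀ (hnz μ hμ hμy s _ (hx s))]
  · have hνy : ν i y ≠ 0 := by
      intro hνy
      have hz : ν i ((μ i (x i))⁻¹ • x i) = 0 :=
        residueForms_apply_eq_zero hν (hrat i) (by rw [hy, hγi]) hνy
          (by rw [(Q i).map_smul_of_ne_zero (inv_ne_zero (hnz μ hμ hμy i _ (hx i))), hx])
      exact one_ne_zero (hνi.symm.trans hz)
    exact hnz ν hν hνy s _
      (by rw [(Q s).map_smul_of_ne_zero (inv_ne_zero (hnz μ hμ hμy s _ (hx s))), hx])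

end RelativeMaximal

/-! ### Pure gaps -/

section PureGaps

variable {Q : Fin m → Place k K}

lemma tupleDivisor_apply (hQ : Function.Injective Q) (α : Fin m → ℤ) (i : Fin m) :
    tupleDivisor Q α (Q i) = α i := by
  classical
  simp [tupleDivisor, Finsupp.finsetSum_apply, Finsupp.single_apply, hQ.eq_iff]

lemma tupleDivisor_apply_of_notMem (α : Fin m → ℤ) {P : Place k K} (hP : P ∉ Set.range Q) :
    tupleDivisor Q α P = 0 := by
  classical
  rw [tupleDivisor, Finsupp.finsetSum_apply]
  exact Finset.sum_eq_zero fun i _ => Finsupp.single_eq_of_ne (fun h => hP ⟨i, h.symm⟩)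

lemma mem_riemannRoch_tupleDivisor (hQ : Function.Injective Q) {α : Fin m → ℤ} {h : K} :
    h ∈ riemannRoch (tupleDivisor Q α) ↔ h ∈ regularOn (k := k) (Set.range Q)ᶜ ∧
      ∀ s, (Q s).valuation h ≤ WithZero.exp (α s) := by
  rw [mem_riemannRoch]
  refine ⟨fun hh => ⟨fun P hP => ?_, fun s => ?_⟩, fun hh P => ?_⟩
  · simpa [tupleDivisor_apply_of_notMem α hP] using hh P
  · simpa [tupleDivisor_apply hQ] using hh (Q s)
  · by_cases hP : P ∈ Set.range Q
    · obtain ⟨s, rfl⟩ := hP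
      simpa [tupleDivisor_apply hQ] using hh.2 s
    · simpa [tupleDivisor_apply_of_notMem α hP] using hh.1 P hP

/-- A tuple is a pure gap if and only if no function with poles bounded by it attains the bound
at some `Q i`. -/
lemma mem_pureGaps_iff (hK : IsCurveFunctionField k K) (hm : 2 ≤ m) (hQ : Function.Injective Q)
    (hrat : ∀ i, (Q i).IsRational) {α : Fin m → ℤ} :
    α ∈ pureGaps Q ↔ 0 ≤ α ∧ ∀ i, ¬ ∃ h ∈ regularOn (k := k) (Set.range Q)ᶜ,
      (Q i).valuation h = WithZero.exp (α i) ∧ ∀ s, (Q s).valuation h ≤ WithZero.exp (α s) := by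
  classical
  have hle : ∀ j, riemannRoch (tupleDivisor Q α - Finsupp.single (Q j) 1) ≤
      riemannRoch (tupleDivisor Q α) := fun j =>
    riemannRoch_mono (sub_le_self _ (Finsupp.single_nonneg.2 zero_le_one))
  constructor
  · rintro ⟨⟨hα, -⟩, hell⟩
    refine ⟨hα, fun i => ?_⟩
    rintro ⟨h, hh, hhi, hhs⟩
    have hfd := finiteDimensional_riemannRoch_tupleDivisor hK hrat α
    have heq := Submodule.eq_of_le_of_finrank_eq (hle i) (hell i).symm
    have hmem : h ∈ riemannRoch (tupleDivisor Q α) :=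
      (mem_riemannRoch_tupleDivisor hQ).2 ⟨hh, hhs⟩
    rw [← heq, mem_riemannRoch] at hmem
    have := hmem (Q i)
    rw [hhi, WithZero.exp_le_exp, Finsupp.sub_apply, tupleDivisor_apply hQ,
      Finsupp.single_eq_same] at this
    omega
  · rintro ⟨hα, hno⟩
    refine ⟨⟨hα, ?_⟩, fun j => ?_⟩
    · rintro ⟨-, h, h0, hpole⟩
      have hval : ∀ P : Place k K, P.valuation h ≤ WithZero.exp (tupleDivisor Q α P) := by
        intro P
        rw [Place.valuation_eq_exp h0, WithZero.exp_le_exp, ← hpole P]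
        exact le_max_right _ _
      have hmem := (mem_riemannRoch_tupleDivisor hQ).1 (mem_riemannRoch.2 hval)
      by_cases hex : ∃ j, 0 < α j
      · obtain ⟨j, hj⟩ := hex
        refine hno j ⟨h, hmem.1, ?_, hmem.2⟩
        have := hpole (Q j)
        rw [tupleDivisor_apply hQ, poleDivisor] at this
        rw [Place.valuation_eq_exp h0, WithZero.exp_inj]
        omega
      · -- For `α = 0` the constant function `1` attains the bound.
        have hα0 : ∀ j, α j = 0 := fun j =>
          le_antisymm (not_lt.1 fun hj => hex ⟨j, hj⟩) (hα j)
        exact hno ⟨0, by omega⟩ ⟨1, fun P _ => by simp, by simp [hα0], fun s => by simp [hα0]⟩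
    · suffices heq : riemannRoch (tupleDivisor Q α) =
          riemannRoch (tupleDivisor Q α - Finsupp.single (Q j) 1) by rw [ell, ell, heq]
      refine le_antisymm (fun h hh => mem_riemannRoch.2 fun P => ?_) (hle j)
      have hh' := (mem_riemannRoch_tupleDivisor hQ).1 hh
      by_cases hP : P = Q j
      · subst hP
        have hlt : (Q j).valuation h < WithZero.exp (α j) :=
          lt_of_le_of_ne (hh'.2 j) fun heq => hno j ⟨h, hh'.1, heq, hh'.2⟩
        rw [Finsupp.sub_apply, tupleDivisor_apply hQ, Finsupp.single_eq_same,
          ← lt_exp_add_one_iff, sub_add_cancel]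
        exact hlt
      · rw [Finsupp.sub_apply, Finsupp.single_eq_of_ne hP, sub_zero]
        exact mem_riemannRoch.1 hh P

end PureGaps

end WeierstrassGap

theorem theorem3p2 {k : Type*} {K : Type*} [Field k] [Finite k] [Field K] [Algebra k K]
    (hK : WeierstrassGap.IsCurveFunctionField k K)
    {m : ℕ} (hm : 2 ≤ m) (hq : m ≤ Nat.card k)
    (Q : Fin m → WeierstrassGap.Place k K) (hQ : Function.Injective Q)
    (hrat : ∀ i, (Q i).IsRational) :
    (WeierstrassGap.pureGaps Q =
      ⋃ β ∈ {β : Fin m → Fin m → ℤ | ∀ i, β i ∈ WeierstrassGap.nonnegRelMaximals Q},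
        ⋂ i, WeierstrassGap.nablaBar {i} (β i)) ∧
    ∀ β : Fin m → Fin m → ℤ, (∀ i, β i ∈ WeierstrassGap.relMaximals Q) →
      (⋂ i, WeierstrassGap.nablaBar {i} (β i)) = ∅ ∨
      (⋂ i, WeierstrassGap.nablaBar {i} (β i)) = {fun i => β i i} := by
  have hdiag : ∀ (β : Fin m → Fin m → ℤ), ∀ α ∈ ⋂ i, WeierstrassGap.nablaBar {i} (β i),
      α = fun i => β i i := fun β α hα =>
    funext fun i => (Set.mem_iInter.1 hα i).1 i (Finset.mem_singleton_self i)
  refine ⟨?_, fun β _ => ?_⟩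
  · ext α
    rw [WeierstrassGap.mem_pureGaps_iff hK hm hQ hrat]
    simp only [Set.mem_iUnion, exists_prop]
    constructor
    · rintro ⟨hα, hno⟩
      choose β hβ hβi hβs using fun i =>
        WeierstrassGap.exists_relMaximal hK ‹_› hm hq hQ hrat hα (hno i)
      refine ⟨β, fun i => ⟨hβ i, fun s => ?_⟩, Set.mem_iInter.2 fun i => ⟨?_, ?_⟩⟩
      · by_cases hs : s = i
        · subst hs; rw [hβi]; exact hα s
        · exact (hα s).trans (hβs i s hs).le
      · intro j hj
        rw [Finset.mem_singleton.1 hj, hβi]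
      · intro s hs
        exact hβs i s (by simpa using hs)
    · rintro ⟨β, hβ, hα⟩
      have hαβ : ∀ i, α i = β i i := congrFun (hdiag β α hα)
      refine ⟨fun i => by rw [hαβ]; exact (hβ i).2 i, fun i => ?_⟩
      rintro ⟨h, hh, hhi, hhs⟩
      have h0 : h ≠ 0 := by
        rintro rfl
        rw [map_zero] at hhi
        exact WithZero.exp_ne_zero hhi.symm
      have hmem := WeierstrassGap.mem_nabla_of_valuation (J := {i}) (γ := β i) h0 hh
        (fun j hj => by rw [Finset.mem_singleton.1 hj, hhi, hαβ])
        (fun j hj => (hhs j).trans_lt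
          (WithZero.exp_lt_exp.2 ((Set.mem_iInter.1 hα i).2 j hj)))
      exact Set.eq_empty_iff_forall_notMem.1 (hβ i).1.1.2 _
        ⟨Set.mem_iUnion.2 ⟨i, hmem.1⟩, hmem.2⟩
  · rcases Set.eq_empty_or_nonempty (⋂ i, WeierstrassGap.nablaBar {i} (β i)) with h | ⟨α, hα⟩
    · exact Or.inl h
    · refine Or.inr (Set.eq_singleton_iff_unique_mem.2 ⟨?_, fun α' hα' => hdiag β α' hα'⟩)
      rwa [← hdiag β α hα]
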